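/- **Proposition 7.1 (sharpness of the order $m$).** Let $n\ge 1$. *Notation.* For Schwartz functions, $\widehat f(\xi)=\int_{\mathbb R^n}e^{-ix\cdot\xi}f(x)\,dx$, and $\mathcal F^{-1}$ denotes the inverse transform. For $\sigma\in L^\infty((\mathbb R^n)^3)$ and $f,g\in\mathcal S(\mathbb R^n)$ put $$T_\sigma(f,g)(x)=\frac1{(2\pi)^{2n}}\int_{(\mathbb R^n)^2}e^{ix\cdot(\xi+\eta)}\sigma(x,\xi,\eta)\,\widehat f(\xi)\,\widehat g(\eta)\,d\xi\,d\eta .$$ We say that $T_\sigma$ is bounded from $L^p\times L^q$ to $L^r$ if there is a constant $C<\infty$ (possibly depending on $\sigma$) such that $\|T_\sigma(f,g)\|_{L^r}\le C\|f\|_{L^p}\|g\|_{L^q}$ for all $f,g\in\mathcal S(\mathbb R^n)$. A Littlewood–Paley partition of unity on $\mathbb R^d$ is a sequence $\psi_0=\phi$, $\psi_k=\phi(\cdot/2^k)-\phi(2\,\cdot/2^k)$ $(k\ge1)$, where $\phi\in\mathcal S(\mathbb R^d)$, $\phi=1$ on $\{|\xi|\le1\}$ and $\operatorname{supp}\phi\subset\{|\xi|\le2\}$.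 Let $\{\psi_k\}_{k\ge0}$ and $\{\Psi_j\}_{j\ge0}$ be any Littlewood–Paley partitions of unity on $\mathbb R^n$ and on $(\mathbb R^n)^2=\mathbb R^{2n}$, respectively. For $\boldsymbol k=(k_0,k_1,k_2)\in\mathbb N_0^3$ and $j\in\mathbb N_0$ put $$\Delta_{\boldsymbol k}\tau=\psi_{k_0}(D_x)\psi_{k_1}(D_\xi)\psi_{k_2}(D_\eta)\tau,\qquad \sigma^\rho_j(x,\xi,\eta)=\sigma(2^{-j\rho}x,2^{j\rho}\xi,2^{j\rho}\eta)\,\Psi_j(2^{j\rho}\xi,2^{j\rho}\eta),$$ where $\psi_k(D)$ is convolution with $\mathcal F^{-1}\psi_k$ in the indicated variable, and let $$\|F\|_{L^2_{ul}((\mathbb R^n)^3)}=\sup_{\nu\in\mathbb Z^{3n}}\Big(\int_{[-1/2,1/2)^{3n}}|F(X+\nu)|^2\,dX\Big)^{1/2}.$$ For $m\in\mathbb R$ and $\boldsymbol s=(s_0,s_1,s_2)\in[0,\infty)^3$, let $BS^m_{\rho,\rho}(\boldsymbol s;\mathbb R^n)$ be the set of all $\sigma\in L^\infty((\mathbb R^n)^3)$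 with $$\sup_{j\in\mathbb N_0}\ \sum_{\boldsymbol k\in\mathbb N_0^3}2^{-jm+k_0s_0+k_1s_1+k_2s_2}\,\|\Delta_{\boldsymbol k}[\sigma^\rho_j]\|_{L^2_{ul}((\mathbb R^n)^3)}<\infty .$$ *Statement.* Let $0\le\rho<1$, $m\in\mathbb R$, $\boldsymbol s\in[0,\infty)^3$, and let $1\le r\le2\le p,q\le\infty$ satisfy $1/p+1/q=1/r$. If $T_\sigma$ is bounded from $L^p(\mathbb R^n)\times L^q(\mathbb R^n)$ to $L^r(\mathbb R^n)$ for every $\sigma\in BS^m_{\rho,\rho}(\boldsymbol s;\mathbb R^n)$, then $$m\le-\frac{(1-\rho)n}{2}.$$ -/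

import Mathlib

open MeasureTheory
open scoped ENNReal NNReal

noncomputable section

namespace BilinearPDO

/-- Euclidean space `ℝⁿ` with its Euclidean norm and Lebesgue measure. -/
abbrev Rn (n : ℕ) : Type := EuclideanSpace ℝ (Fin n)

/-- The space `(ℝⁿ)³` of triples `(x, ξ, η)`; its measure is the product Lebesgue measure. -/
abbrev Rn3 (n : ℕ) : Type := Rn n × Rn n × Rn n

/-- The Fourier transform `f̂(ξ) = ∫ e^{-i x·ξ} f(x) dx`. -/
def fourierHat {n : ℕ} (f : Rn n → ℂ) (ξ : Rn n) : ℂ :=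
  ∫ x : Rn n, Complex.exp (-(Complex.I * ((inner ℝ x ξ : ℝ) : ℂ))) * f x

/-- The inverse Fourier transform `(2π)^{-n} ∫ e^{i x·ξ} f(ξ) dξ`. -/
def fourierCheck {n : ℕ} (f : Rn n → ℂ) (x : Rn n) : ℂ :=
  (((2 * Real.pi) ^ n : ℝ) : ℂ)⁻¹ *
    ∫ ξ : Rn n, Complex.exp (Complex.I * ((inner ℝ x ξ : ℝ) : ℂ)) * f ξ

/-- The bilinear pseudo-differential operator
`T_σ(f, g)(x) = (2π)^{-2n} ∫∫ e^{i x·(ξ+η)} σ(x, ξ, η) f̂(ξ) ĝ(η) dξ dη`. -/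
def bilinearOp {n : ℕ} (σ : Rn3 n → ℂ) (f g : SchwartzMap (Rn n) ℂ) (x : Rn n) : ℂ :=
  (((2 * Real.pi) ^ (2 * n) : ℝ) : ℂ)⁻¹ *
    ∫ z : Rn n × Rn n,
      Complex.exp (Complex.I * ((inner ℝ x (z.1 + z.2) : ℝ) : ℂ)) * σ (x, z.1, z.2) *
        fourierHat f z.1 * fourierHat g z.2

/-- `T_σ` is bounded from `L^p × L^q` to `L^r`: there is a finite constant `C` (which may depend
on `σ`) with `‖T_σ(f, g)‖_{L^r} ≤ C ‖f‖_{L^p} ‖g‖_{L^q}` for all Schwartz functions `f`, `g`. -/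
def IsBoundedFromTo {n : ℕ} (σ : Rn3 n → ℂ) (p q r : ℝ≥0∞) : Prop :=
  ∃ C : ℝ≥0, ∀ f g : SchwartzMap (Rn n) ℂ,
    eLpNorm (bilinearOp σ f g) r volume ≤
      (C : ℝ≥0∞) * eLpNorm (⇑f) p volume * eLpNorm (⇑g) q volume

/-- A Schwartz function `φ` that generates a Littlewood–Paley partition of unity:
`φ = 1` on `{|ξ| ≤ 1}` and `supp φ ⊆ {|ξ| ≤ 2}`. -/
structure IsLPGenerator {V : Type*} [NormedAddCommGroup V] [NormedSpace ℝ V]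
    (φ : SchwartzMap V ℂ) : Prop where
  eq_one : ∀ ξ : V, ‖ξ‖ ≤ 1 → φ ξ = 1
  tsupport_subset : tsupport (⇑φ) ⊆ Metric.closedBall (0 : V) 2

/-- The Littlewood–Paley partition of unity generated by `φ`: with `ψ = φ - φ(2·)`, it is
`ψ_0 = φ` and `ψ_k = ψ(·/2^k)` for `k ≥ 1`. -/
def lpPiece {V : Type*} [NormedAddCommGroup V] [NormedSpace ℝ V]
    (φ : SchwartzMap V ℂ) (k : ℕ) (ξ : V) : ℂ :=
  if k = 0 then φ ξ
  else φ (((2 : ℝ) ^ k)⁻¹ • ξ) - φ ((2 : ℝ) • ((2 : ℝ) ^ k)⁻¹ • ξ)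

/-- `Δ_k τ = ψ_{k₀}(D_x) ψ_{k₁}(D_ξ) ψ_{k₂}(D_η) τ` for a bounded measurable `τ`. Here
`ψ_k(D)` is convolution with the inverse Fourier transform of `ψ_k`, so `Δ_k τ` is the
convolution of `τ` with the tensor product of the three (integrable) kernels. -/
def lpBlock {n : ℕ} (φ : SchwartzMap (Rn n) ℂ) (k : Fin 3 → ℕ) (τ : Rn3 n → ℂ)
    (X : Rn3 n) : ℂ :=
  ∫ Y : Rn3 n,
    fourierCheck (lpPiece φ (k 0)) Y.1 * fourierCheck (lpPiece φ (k 1)) Y.2.1 *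
      fourierCheck (lpPiece φ (k 2)) Y.2.2 * τ (X - Y)

/-- The localized and rescaled symbol
`σ_j^ρ(x, ξ, η) = σ(2^{-jρ} x, 2^{jρ} ξ, 2^{jρ} η) Ψ_j(2^{jρ} ξ, 2^{jρ} η)`, where `Ψ_j` is the
Littlewood–Paley partition on `(ℝⁿ)² = ℝ²ⁿ` (Euclidean norm) generated by `Φ`. -/
def rescaledSymbol {n : ℕ} (Φ : SchwartzMap (WithLp 2 (Rn n × Rn n)) ℂ) (ρ : ℝ)
    (σ : Rn3 n → ℂ) (j : ℕ) (X : Rn3 n) : ℂ :=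
  σ ((2 : ℝ) ^ (-((j : ℝ) * ρ)) • X.1, (2 : ℝ) ^ ((j : ℝ) * ρ) • X.2.1,
      (2 : ℝ) ^ ((j : ℝ) * ρ) • X.2.2) *
    lpPiece Φ j (WithLp.toLp 2
      ((2 : ℝ) ^ ((j : ℝ) * ρ) • X.2.1, (2 : ℝ) ^ ((j : ℝ) * ρ) • X.2.2))

/-- The unit cube `[-1/2, 1/2)ⁿ`. -/
def unitCube (n : ℕ) : Set (Rn n) :=
  {x | ∀ i, x i ∈ Set.Ico (-(1 / 2) : ℝ) (1 / 2)}

/-- The lattice point `ν ∈ ℤⁿ` as a vector of `ℝⁿ`. -/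
def latticePoint {n : ℕ} (ν : Fin n → ℤ) : Rn n :=
  WithLp.toLp 2 (fun i => (ν i : ℝ))

/-- The uniformly local `L²` norm on `(ℝⁿ)³`, with value `∞` allowed: the supremum over
`ν ∈ ℤ³ⁿ` of the `L²` norms of `F(· + ν)` over the unit cube `[-1/2, 1/2)³ⁿ`. -/
def ulNorm {n : ℕ} (F : Rn3 n → ℂ) : ℝ≥0∞ :=
  ⨆ ν : (Fin n → ℤ) × (Fin n → ℤ) × (Fin n → ℤ),
    eLpNorm
      (fun X : Rn3 n => F (X + (latticePoint ν.1, latticePoint ν.2.1, latticePoint ν.2.2)))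
      2 (volume.restrict (unitCube n ×ˢ unitCube n ×ˢ unitCube n))

/-- The norm `sup_j ∑_k 2^{-jm + k·s} ‖Δ_k [σ_j^ρ]‖_{L²_ul}`, with value `∞` allowed. -/
def symbolNorm {n : ℕ} (φ : SchwartzMap (Rn n) ℂ) (Φ : SchwartzMap (WithLp 2 (Rn n × Rn n)) ℂ)
    (m ρ : ℝ) (s : Fin 3 → ℝ) (σ : Rn3 n → ℂ) : ℝ≥0∞ :=
  ⨆ j : ℕ, ∑' k : Fin 3 → ℕ,
    ENNReal.ofReal ((2 : ℝ) ^ (-((j : ℝ) * m) + ∑ i, (k i : ℝ) * s i)) *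
      ulNorm (lpBlock φ k (rescaledSymbol Φ ρ σ j))

/-- The Besov type symbol class `BS^m_{ρ,ρ}(s; ℝⁿ)`: the `σ ∈ L^∞((ℝⁿ)³)` of finite norm. -/
def symbolClass {n : ℕ} (φ : SchwartzMap (Rn n) ℂ) (Φ : SchwartzMap (WithLp 2 (Rn n × Rn n)) ℂ)
    (m ρ : ℝ) (s : Fin 3 → ℝ) : Set (Rn3 n → ℂ) :=
  {σ | MemLp σ ∞ volume ∧ symbolNorm φ Φ m ρ s σ < ∞}

end BilinearPDO

end

noncomputable section

open SchwartzMap FourierTransform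

namespace BilinearPDO

/-! ### Unimodular exponentials -/

/-! The symbol class admits arbitrary signs on a lattice of bumps, and signs can be chosen to make
the operator coherent on very flat inputs. At frequency `2^J` put bumps of width `l = 2^{Jρ}` at the
points `l(κ, κ')`, with `κ`, `κ'` in the box `[2^M, 2^{M+1})ⁿ` and `M = ⌊J(1-ρ)⌋`. Give them
coefficients `A_M(κ) A_M(κ') A_{M+1}(κ+κ')`, where the `A` are tensor products of Rudin-Shapiro
signs (`exists_flat_trigPoly`). The symbol is the lacunary sum over `J` of `2^{Jm'}` times these
pieces.

Lower bound (`exists_rpow_mul_le`): take `f = g` with `f̂` a sum of narrow profiles at `lκ` weighted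
by `A_M(κ)`. Flatness makes every `L^p` norm of `f` at most a constant times `2^{nM/2}`. The
operator cancels the signs `A_M`. Pairing the output with a flat polynomial with coefficients
`A_{M+1}` then cancels the remaining signs, so all `2^{2nM}` terms add up. Boundedness and Hölder
give `2^{Jm'} 2^{2nM} ≲ 2^{3nM/2}`, so `2^{Jm'} 2^{nM/2}` is bounded in `J`. This forces `m' ≤
-(1-ρ)n/2` (`critical_order_of_bounded`).

Membership (`lacunarySymbol_mem_symbolClass`): after rescaling, `Ψ_j` sees one piece, made of
unit-scale bumps. Its blocks are bounded uniformly because the bumps are disjoint, and decay rapidly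
in `k` up to the number `2^{2nM}` of bumps. Interpolation costs an arbitrarily small power of `2^j`,
so the symbol of order `m'` lies in the class of every order `m > m'`, whatever `s` is. -/

/-- The character `t ↦ e^{it}`. -/
def expI (t : ℝ) : ℂ := Complex.exp (Complex.I * (t : ℂ))

lemma expI_add (s t : ℝ) : expI (s + t) = expI s * expI t := by
  simp [expI, mul_add, Complex.exp_add]

@[simp] lemma expI_zero : expI 0 = 1 := by simp [expI]

@[simp] lemma norm_expI (t : ℝ) : ‖expI t‖ = 1 := by
  rw [expI, mul_comm]; exact Complex.norm_exp_ofReal_mul_I t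

lemma expI_neg (t : ℝ) : Complex.exp (-(Complex.I * (t : ℂ))) = expI (-t) := by
  simp [expI]

lemma expI_sum {ι : Type*} (s : Finset ι) (f : ι → ℝ) :
    expI (∑ i ∈ s, f i) = ∏ i ∈ s, expI (f i) := by
  simp [expI, Finset.mul_sum, Complex.exp_sum]

lemma expI_nat_mul (k : ℕ) (t : ℝ) : expI (k * t) = expI t ^ k := by
  rw [expI, expI, ← Complex.exp_nat_mul]
  congr 1
  push_cast
  ring

@[fun_prop]
lemma continuous_expI : Continuous expI := by
  unfold expI
  fun_prop

@[fun_prop]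
lemma measurable_expI : Measurable expI := continuous_expI.measurable

lemma fourierHat_eq {n : ℕ} (f : Rn n → ℂ) (ξ : Rn n) :
    fourierHat f ξ = ∫ x : Rn n, expI (-(inner ℝ x ξ : ℝ)) * f x := by
  simp only [fourierHat, expI_neg]

lemma fourierCheck_eq {n : ℕ} (f : Rn n → ℂ) (x : Rn n) :
    fourierCheck f x = (((2 * Real.pi) ^ n : ℝ) : ℂ)⁻¹ *
      ∫ ξ : Rn n, expI (inner ℝ x ξ : ℝ) * f ξ := rfl

/-! ### Dilations and Fourier inversion -/

section Dilation

variable {V : Type*} [NormedAddCommGroup V] [InnerProductSpace ℝ V]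

/-- The dilation `x ↦ f (c • x)` of a Schwartz function. -/
def dilate (c : ℝ) (hc : c ≠ 0) (f : 𝓢(V, ℂ)) : 𝓢(V, ℂ) :=
  compCLMOfContinuousLinearEquiv ℂ (ContinuousLinearEquiv.smulLeft (R₁ := ℝ) (Units.mk0 c hc)) f

@[simp] lemma dilate_apply (c : ℝ) (hc : c ≠ 0) (f : 𝓢(V, ℂ)) (x : V) :
    dilate c hc f x = f (c • x) := rfl

end Dilation

section Schwartz

variable {V : Type*} [NormedAddCommGroup V] [InnerProductSpace ℝ V] [FiniteDimensional ℝ V]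
  [MeasurableSpace V] [BorelSpace V]

lemma fourier_eq_expI (f : V → ℂ) (w : V) :
    𝓕 f w = ∫ v : V, expI (-(2 * Real.pi * inner ℝ v w)) * f v := by
  rw [Real.fourier_eq']
  refine integral_congr_ae (.of_forall fun v => ?_)
  simp only [expI, smul_eq_mul]
  congr 2
  push_cast
  ring

lemma fourierInv_eq_expI (f : V → ℂ) (w : V) :
    𝓕⁻ f w = ∫ v : V, expI (2 * Real.pi * inner ℝ v w) * f v := by
  rw [Real.fourierInv_eq']
  refine integral_congr_ae (.of_forall fun v => ?_)
  simp only [expI, smul_eq_mul]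
  congr 2
  push_cast
  ring

lemma schwartz_inversion (f : 𝓢(V, ℂ)) (v : V) :
    f v = ∫ y : V, expI (2 * Real.pi * inner ℝ y v) * 𝓕 f y := by
  have h : 𝓕⁻ (𝓕 f) = f := fourierInv_fourier_eq f
  conv_lhs => rw [← h, fourierInv_coe, fourierInv_eq_expI]

end Schwartz

lemma two_pi_ne : (2 * Real.pi : ℝ) ≠ 0 := by positivity

/-- Fourier inversion in the normalization of `fourierHat` and `fourierCheck`. -/
lemma exists_schwartz_fourierCheck {n : ℕ} (ψ : 𝓢(Rn n, ℂ)) :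
    ∃ K : 𝓢(Rn n, ℂ), (∀ y, fourierCheck ψ y = K y) ∧
      ∀ a : Rn n, ∫ y, expI (-(inner ℝ y a : ℝ)) * K y = ψ a := by
  refine ⟨𝓕⁻ (dilate (2 * Real.pi) two_pi_ne ψ), fun y => ?_, fun a => ?_⟩
  · rw [fourierInv_coe, fourierInv_eq_expI, fourierCheck_eq]
    have := Measure.integral_comp_smul (volume : Measure (Rn n))
      (fun ξ : Rn n => expI (inner ℝ y ξ : ℝ) * ψ ξ) (2 * Real.pi)
    simp only [inner_smul_right, finrank_euclideanSpace, Fintype.card_fin] at this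
    simp only [dilate_apply, real_inner_comm y] at this ⊢
    rw [this, abs_of_pos (by positivity), Complex.real_smul]
    push_cast
    rfl
  · have h := congrArg (fun g : 𝓢(Rn n, ℂ) => g ((2 * Real.pi)⁻¹ • a))
      (fourier_fourierInv_eq (F := 𝓢(Rn n, ℂ)) (dilate (2 * Real.pi) two_pi_ne ψ))
    simp only [fourier_coe, fourier_eq_expI, dilate_apply, smul_inv_smul₀ two_pi_ne] at h
    rw [← h]
    refine integral_congr_ae (.of_forall fun v => ?_)
    simp only [inner_smul_right, mul_inv_cancel_left₀ two_pi_ne]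

/-! ### Littlewood-Paley pieces -/

section LP

variable {V : Type*} [NormedAddCommGroup V] [InnerProductSpace ℝ V]

lemma exists_schwartz_lpPiece (φ : 𝓢(V, ℂ)) (k : ℕ) : ∃ ψ : 𝓢(V, ℂ), ⇑ψ = lpPiece φ k := by
  rcases eq_or_ne k 0 with rfl | hk
  · exact ⟨φ, by ext ξ; simp [lpPiece]⟩
  · refine ⟨dilate ((2 : ℝ) ^ k)⁻¹ (by positivity) φ -
      dilate (2 * ((2 : ℝ) ^ k)⁻¹) (by positivity) φ, ?_⟩
    ext ξ
    simp [lpPiece, hk, mul_smul]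

lemma norm_lpPiece_le {φ : 𝓢(V, ℂ)} {B : ℝ} (hB : ∀ x, ‖φ x‖ ≤ B) (k : ℕ) (ξ : V) :
    ‖lpPiece φ k ξ‖ ≤ 2 * B := by
  have hB0 : 0 ≤ B := (norm_nonneg _).trans (hB 0)
  unfold lpPiece
  split_ifs
  · linarith [hB ξ]
  · refine (norm_sub_le _ _).trans ?_
    linarith [hB (((2 : ℝ) ^ k)⁻¹ • ξ), hB ((2 : ℝ) • ((2 : ℝ) ^ k)⁻¹ • ξ)]

lemma exists_schwartz_bound (φ : 𝓢(V, ℂ)) : ∃ B : ℝ, ∀ x, ‖φ x‖ ≤ B :=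
  ⟨_, fun x => φ.norm_le_seminorm ℂ x⟩

lemma IsLPGenerator.eq_zero {φ : 𝓢(V, ℂ)} (hφ : IsLPGenerator φ) {ξ : V} (h : 2 < ‖ξ‖) :
    φ ξ = 0 := by
  by_contra h0
  have := hφ.tsupport_subset (subset_tsupport _ (Function.mem_support.2 h0))
  rw [mem_closedBall_zero_iff] at this
  linarith

lemma IsLPGenerator.lpPiece_eq_zero_of_lt {φ : 𝓢(V, ℂ)} (hφ : IsLPGenerator φ) {k : ℕ}
    {ξ : V} (h : 2 * ‖ξ‖ ≤ 2 ^ k) (hk : k ≠ 0) : lpPiece φ k ξ = 0 := by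
  have h1 : ‖(2 : ℝ) • ((2 : ℝ) ^ k)⁻¹ • ξ‖ ≤ 1 := by
    rw [norm_smul, norm_smul, Real.norm_of_nonneg (by positivity),
      Real.norm_of_nonneg (by positivity)]
    calc 2 * (((2 : ℝ) ^ k)⁻¹ * ‖ξ‖) = (2 * ‖ξ‖) / 2 ^ k := by field_simp
      _ ≤ 1 := (div_le_one (by positivity)).2 h
  have h2 : ‖((2 : ℝ) ^ k)⁻¹ • ξ‖ ≤ 1 := by
    rw [norm_smul, Real.norm_of_nonneg (by norm_num : (0:ℝ) ≤ 2)] at h1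
    linarith [norm_nonneg (((2 : ℝ) ^ k)⁻¹ • ξ)]
  simp [lpPiece, hk, hφ.eq_one _ h1, hφ.eq_one _ h2]

lemma IsLPGenerator.lpPiece_eq_zero_of_gt {φ : 𝓢(V, ℂ)} (hφ : IsLPGenerator φ) {k : ℕ}
    {ξ : V} (h : 2 * 2 ^ k < ‖ξ‖) : lpPiece φ k ξ = 0 := by
  have h2 : 2 < ‖((2 : ℝ) ^ k)⁻¹ • ξ‖ := by
    rw [norm_smul, Real.norm_of_nonneg (by positivity), inv_mul_eq_div,
      lt_div_iff₀ (by positivity)]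
    exact h
  have h1 : 2 < ‖(2 : ℝ) • ((2 : ℝ) ^ k)⁻¹ • ξ‖ := by
    rw [norm_smul, Real.norm_of_nonneg (by norm_num : (0:ℝ) ≤ 2)]
    linarith
  have h0 : k = 0 → φ ξ = 0 := by
    rintro rfl
    refine hφ.eq_zero ?_
    simpa using h
  unfold lpPiece
  split_ifs with hk
  · exact h0 hk
  · simp [hφ.eq_zero h1, hφ.eq_zero h2]

/-- The piece vanishes unless `2^k ≤ 2(1 + ‖a‖)`, so powers of `2^{-k}` can be traded for powers of
`1 + ‖a‖`. -/
lemma IsLPGenerator.exists_lpPiece_decay {φ : 𝓢(V, ℂ)} (hφ : IsLPGenerator φ) (N : ℕ) :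
    ∃ C : ℝ, 0 ≤ C ∧ ∀ (k : ℕ) (a : V),
      ‖lpPiece φ k a‖ ≤ C * ((2 : ℝ) ^ (k * N))⁻¹ * (1 + ‖a‖) ^ N := by
  obtain ⟨B, hB⟩ := exists_schwartz_bound φ
  have hB0 : 0 ≤ B := (norm_nonneg _).trans (hB 0)
  refine ⟨2 * B * 2 ^ N, by positivity, fun k a => ?_⟩
  by_cases h : (2 : ℝ) ^ k ≤ 2 * (1 + ‖a‖)
  · have h1 : (2 : ℝ) ^ (k * N) ≤ 2 ^ N * (1 + ‖a‖) ^ N := by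
      rw [pow_mul, ← mul_pow]
      exact pow_le_pow_left₀ (by positivity) h N
    calc ‖lpPiece φ k a‖ ≤ 2 * B := norm_lpPiece_le hB k a
      _ = 2 * B * ((2 : ℝ) ^ (k * N))⁻¹ * (2 : ℝ) ^ (k * N) := by field_simp
      _ ≤ 2 * B * ((2 : ℝ) ^ (k * N))⁻¹ * (2 ^ N * (1 + ‖a‖) ^ N) := by gcongr
      _ = _ := by ring
  · push Not at h
    have hk : k ≠ 0 := by
      rintro rfl
      have := norm_nonneg a
      norm_num at h
      linarith
    rw [hφ.lpPiece_eq_zero_of_lt (by linarith) hk, norm_zero]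
    positivity

end LP

lemma fourierCheck_comp_smul {n : ℕ} (f : Rn n → ℂ) {c : ℝ} (hc : 0 < c) (y : Rn n) :
    fourierCheck (fun ξ => f (c • ξ)) y = ((c ^ n)⁻¹ : ℝ) • fourierCheck f (c⁻¹ • y) := by
  rw [fourierCheck_eq, fourierCheck_eq]
  have := Measure.integral_comp_smul (volume : Measure (Rn n))
      (fun ξ : Rn n => expI (inner ℝ (c⁻¹ • y) ξ : ℝ) * f ξ) c
  simp only [inner_smul_right, inner_smul_left, finrank_euclideanSpace, Fintype.card_fin,
    abs_of_pos (show 0 < (c ^ n)⁻¹ by positivity), conj_trivial,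
    mul_inv_cancel_left₀ hc.ne'] at this
  rw [this]
  simp only [Complex.real_smul, inner_smul_left, conj_trivial]
  ring

/-- The convolution kernels of the Littlewood-Paley projections are uniformly integrable. -/
lemma exists_integral_norm_fourierCheck_le {n : ℕ} (φ : 𝓢(Rn n, ℂ)) :
    ∃ C : ℝ, 0 ≤ C ∧ ∀ k : ℕ, Integrable (fourierCheck (lpPiece φ k)) ∧
      ∫ y, ‖fourierCheck (lpPiece φ k) y‖ ≤ C := by
  have hint : ∀ ψ : 𝓢(Rn n, ℂ), Integrable (fourierCheck ψ) := fun ψ => by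
    obtain ⟨K, hK, -⟩ := exists_schwartz_fourierCheck ψ
    rw [show fourierCheck ψ = K from funext hK]
    exact K.integrable
  let δ : 𝓢(Rn n, ℂ) := φ - dilate 2 (by norm_num) φ
  refine ⟨max (∫ y, ‖fourierCheck (lpPiece φ 0) y‖) (∫ y, ‖fourierCheck δ y‖),
    le_max_of_le_left (by positivity), fun k => ⟨?_, ?_⟩⟩
  · obtain ⟨ψ, hψ⟩ := exists_schwartz_lpPiece φ k
    rw [← hψ]
    exact hint ψ
  · rcases eq_or_ne k 0 with rfl | hk
    · exact le_max_left _ _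
    · refine le_max_of_le_right (le_of_eq ?_)
      -- For `k ≥ 1` all pieces are dilates of one function, and the resulting dilation of kernels
      -- preserves the `L¹` norm.
      have h1 : lpPiece φ k = fun ξ => δ (((2 : ℝ) ^ k)⁻¹ • ξ) := by
        ext ξ
        simp [lpPiece, hk, δ]
      have hc : (0 : ℝ) < ((2 : ℝ) ^ k)⁻¹ := by positivity
      rw [h1]
      simp only [fourierCheck_comp_smul δ hc, norm_smul]
      rw [integral_const_mul, Measure.integral_comp_smul volume (fun y => ‖fourierCheck δ y‖)]
      simp only [finrank_euclideanSpace, Fintype.card_fin, inv_inv, smul_eq_mul, Real.norm_eq_abs,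
        ← mul_assoc, ← abs_mul]
      rw [inv_pow, inv_inv, mul_inv_cancel₀ (by positivity), abs_one, one_mul]

/-! ### Bounds for the frequency blocks `Δ_k` -/

/-- The tensor product kernel of `Δ_k`. -/
def blockKernel {n : ℕ} (φ : 𝓢(Rn n, ℂ)) (k : Fin 3 → ℕ) (Y : Rn3 n) : ℂ :=
  fourierCheck (lpPiece φ (k 0)) Y.1 * fourierCheck (lpPiece φ (k 1)) Y.2.1 *
      fourierCheck (lpPiece φ (k 2)) Y.2.2

lemma lpBlock_eq {n : ℕ} (φ : 𝓢(Rn n, ℂ)) (k : Fin 3 → ℕ) (τ : Rn3 n → ℂ) (X : Rn3 n) :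
    lpBlock φ k τ X = ∫ Y, blockKernel φ k Y * τ (X - Y) := rfl

lemma integrable_blockKernel {n : ℕ} (φ : 𝓢(Rn n, ℂ)) (k : Fin 3 → ℕ) :
    Integrable (blockKernel φ k) := by
  obtain ⟨C, -, hC⟩ := exists_integral_norm_fourierCheck_le φ
  have := (hC (k 0)).1.mul_prod ((hC (k 1)).1.mul_prod (hC (k 2)).1)
  unfold blockKernel
  simp only [mul_assoc]
  exact this

/-- Young's inequality `L¹ * L^∞`; the point is that the constant does not depend on `k`. -/
lemma exists_norm_lpBlock_le {n : ℕ} (φ : 𝓢(Rn n, ℂ)) :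
    ∃ C : ℝ, 0 ≤ C ∧ ∀ (k : Fin 3 → ℕ) (τ : Rn3 n → ℂ) (M : ℝ), (∀ X, ‖τ X‖ ≤ M) →
      ∀ X, ‖lpBlock φ k τ X‖ ≤ C * M := by
  obtain ⟨C, hC0, hC⟩ := exists_integral_norm_fourierCheck_le φ
  refine ⟨C * (C * C), by positivity, fun k τ M hM X => ?_⟩
  have hM0 : 0 ≤ M := (norm_nonneg _).trans (hM 0)
  rw [lpBlock_eq]
  have h1 : ‖∫ Y, blockKernel φ k Y * τ (X - Y)‖ ≤ ∫ Y, ‖blockKernel φ k Y‖ * M := by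
    refine norm_integral_le_of_norm_le ((integrable_blockKernel φ k).norm.mul_const M)
      (.of_forall fun Y => ?_)
    rw [norm_mul]
    gcongr
    exact hM _
  refine h1.trans ?_
  rw [integral_mul_const]
  gcongr
  have h2 : ∫ Y, ‖blockKernel φ k Y‖ = (∫ y, ‖fourierCheck (lpPiece φ (k 0)) y‖) *
      ((∫ y, ‖fourierCheck (lpPiece φ (k 1)) y‖) *
        ∫ y, ‖fourierCheck (lpPiece φ (k 2)) y‖) := by
    rw [← integral_prod_mul, ← integral_prod_mul]
    simp only [blockKernel, norm_mul, mul_assoc]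
    rfl
  rw [h2]
  have := fun i => (hC (k i)).2
  gcongr <;> exact this _

lemma lpBlock_finset_sum {n : ℕ} (φ : 𝓢(Rn n, ℂ)) (k : Fin 3 → ℕ) {ι : Type*} (s : Finset ι)
    (c : ι → ℂ) (τ : ι → Rn3 n → ℂ) (hτ : ∀ i ∈ s, Continuous (τ i))
    (hb : ∀ i ∈ s, ∃ M, ∀ X, ‖τ i X‖ ≤ M) (X : Rn3 n) :
    lpBlock φ k (fun X => ∑ i ∈ s, c i * τ i X) X = ∑ i ∈ s, c i * lpBlock φ k (τ i) X := by
  simp only [lpBlock_eq, Finset.mul_sum]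
  rw [integral_finsetSum]
  · refine Finset.sum_congr rfl fun i _ => ?_
    rw [← integral_const_mul]
    congr 1
    ext Y
    ring
  · intro i hi
    obtain ⟨M, hM⟩ := hb i hi
    have : Integrable fun Y => τ i (X - Y) * blockKernel φ k Y :=
      (integrable_blockKernel φ k).bdd_mul (c := M)
        ((hτ i hi).comp (continuous_const.sub continuous_id)).aestronglyMeasurable
        (.of_forall fun Y => hM _)
    refine (this.const_mul (c i)).congr (.of_forall fun Y => ?_)
    simp only
    ring

/-- `Δ_k` acts on a superposition of exponentials by multiplication on the frequency side. -/
lemma lpBlock_superposition {n : ℕ} (φ : 𝓢(Rn n, ℂ)) (k : Fin 3 → ℕ) {Ω : Type*}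
    [MeasurableSpace Ω] {μ : Measure Ω} [SFinite μ] {w : Ω → ℂ} (hw : Integrable w μ)
    {a b : Ω → Rn n} (ha : Measurable a) (hb : Measurable b) (X : Rn3 n) :
    lpBlock φ k (fun X => ∫ ω, expI (inner ℝ X.2.1 (a ω) + inner ℝ X.2.2 (b ω)) * w ω ∂μ) X =
      ∫ ω, expI (inner ℝ X.2.1 (a ω) + inner ℝ X.2.2 (b ω)) * w ω *
        (lpPiece φ (k 0) 0 * lpPiece φ (k 1) (a ω) * lpPiece φ (k 2) (b ω)) ∂μ := by
  have hK : ∀ i : Fin 3, ∃ K : 𝓢(Rn n, ℂ), (∀ y, fourierCheck (lpPiece φ (k i)) y = K y) ∧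
      ∀ a : Rn n, ∫ y, expI (-(inner ℝ y a : ℝ)) * K y = lpPiece φ (k i) a := fun i => by
    obtain ⟨ψ, hψ⟩ := exists_schwartz_lpPiece φ (k i)
    rw [← hψ]
    exact exists_schwartz_fourierCheck ψ
  choose K hK1 hK2 using hK
  have hswap : Integrable (Function.uncurry fun (Y : Rn3 n) (ω : Ω) =>
      expI (inner ℝ (X - Y).2.1 (a ω) + inner ℝ (X - Y).2.2 (b ω)) *
        (blockKernel φ k Y * w ω)) (volume.prod μ) := by
    refine ((integrable_blockKernel φ k).mul_prod hw).bdd_mul (c := 1) ?_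
      (.of_forall fun _ => (norm_expI _).le)
    refine Measurable.aestronglyMeasurable ?_
    refine measurable_expI.comp (Measurable.add ?_ ?_)
    · exact (measurable_const.sub measurable_fst).snd.fst.inner (ha.comp measurable_snd)
    · exact (measurable_const.sub measurable_fst).snd.snd.inner (hb.comp measurable_snd)
  have hin : ∀ ω, ∫ Y : Rn3 n,
      expI (inner ℝ (X - Y).2.1 (a ω) + inner ℝ (X - Y).2.2 (b ω)) * (blockKernel φ k Y * w ω) =
      expI (inner ℝ X.2.1 (a ω) + inner ℝ X.2.2 (b ω)) * w ω *
        (lpPiece φ (k 0) 0 * lpPiece φ (k 1) (a ω) * lpPiece φ (k 2) (b ω)) := fun ω => by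
    -- The superposition does not depend on `x`, so the multiplier in that variable is evaluated at
    -- frequency zero.
    rw [← hK2 0, ← hK2 1, ← hK2 2, mul_assoc (∫ y, _), ← integral_prod_mul, ← integral_prod_mul,
      ← integral_const_mul]
    refine integral_congr_ae (.of_forall fun Y => ?_)
    simp only [blockKernel, hK1, Prod.snd_sub, Prod.fst_sub, inner_sub_left, inner_zero_right,
      neg_zero, expI_zero]
    rw [show inner ℝ X.2.1 (a ω) - inner ℝ Y.2.1 (a ω) + (inner ℝ X.2.2 (b ω) -
      inner ℝ Y.2.2 (b ω)) = (inner ℝ X.2.1 (a ω) + inner ℝ X.2.2 (b ω)) +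
        (-inner ℝ Y.2.1 (a ω)) + -inner ℝ Y.2.2 (b ω) by ring, expI_add _ (-inner ℝ Y.2.2 (b ω)),
      expI_add _ (-inner ℝ Y.2.1 (a ω))]
    ring
  simp only [lpBlock_eq]
  rw [← integral_congr_ae (.of_forall hin), ← integral_integral_swap hswap]
  refine integral_congr_ae (.of_forall fun Y => ?_)
  simp only [← integral_const_mul]
  refine integral_congr_ae (.of_forall fun ω => ?_)
  simp only
  ring

/-! ### Rapid decay of the blocks of a single bump -/

lemma integrable_one_add_norm_pow_mul {V : Type*} [NormedAddCommGroup V] [InnerProductSpace ℝ V]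
    [FiniteDimensional ℝ V] [MeasurableSpace V] [BorelSpace V] (f : 𝓢(V, ℂ)) (N : ℕ) :
    Integrable fun y => (1 + ‖y‖) ^ N * ‖f y‖ := by
  have : Integrable fun y => 2 ^ N * (‖f y‖ + ‖y‖ ^ N * ‖f y‖) :=
    (f.integrable.norm.add (f.integrable_pow_mul volume N)).const_mul _
  refine this.mono' (by have := f.continuous; fun_prop) (.of_forall fun y => ?_)
  rw [Real.norm_of_nonneg (by positivity)]
  have h : (1 + ‖y‖) ^ N ≤ 2 ^ N * (1 + ‖y‖ ^ N) := by
    have h1 : 1 + ‖y‖ ≤ 2 * max 1 ‖y‖ := by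
      linarith [le_max_left 1 ‖y‖, le_max_right 1 ‖y‖]
    calc (1 + ‖y‖) ^ N ≤ (2 * max 1 ‖y‖) ^ N := by gcongr
      _ = 2 ^ N * (max 1 ‖y‖) ^ N := mul_pow _ _ _
      _ ≤ 2 ^ N * (1 + ‖y‖ ^ N) := by
        gcongr
        rcases le_total 1 ‖y‖ with h | h
        · simp [h]
        · simp [h]
  calc (1 + ‖y‖) ^ N * ‖f y‖ ≤ 2 ^ N * (1 + ‖y‖ ^ N) * ‖f y‖ := by gcongr
    _ = _ := by ring

/-- The localized bump `θ(tξ - κ) θ(tη - κ') Φ(δ(ξ, η))`. -/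
def bumpTerm {n : ℕ} (θ : 𝓢(Rn n, ℂ)) (Φ : 𝓢(WithLp 2 (Rn n × Rn n), ℂ)) (t δ : ℝ)
    (κ κ' : Rn n) (X : Rn3 n) : ℂ :=
  θ (t • X.2.1 - κ) * θ (t • X.2.2 - κ') * Φ (δ • WithLp.toLp 2 (X.2.1, X.2.2))

lemma continuous_bumpTerm {n : ℕ} (θ : 𝓢(Rn n, ℂ)) (Φ : 𝓢(WithLp 2 (Rn n × Rn n), ℂ)) (t δ : ℝ)
    (κ κ' : Rn n) : Continuous (bumpTerm θ Φ t δ κ κ') := by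
  have := θ.continuous
  have := Φ.continuous
  unfold bumpTerm
  fun_prop

/-- Fourier inversion in each of the three factors; this is the form to which
`lpBlock_superposition` applies. -/
lemma bumpTerm_eq_superposition {n : ℕ} (θ : 𝓢(Rn n, ℂ)) (Φ : 𝓢(WithLp 2 (Rn n × Rn n), ℂ))
    (t δ : ℝ) (κ κ' : Rn n) (X : Rn3 n) :
    bumpTerm θ Φ t δ κ κ' X = ∫ ω : Rn n × Rn n × WithLp 2 (Rn n × Rn n),
      expI (inner ℝ X.2.1 ((2 * Real.pi) • (t • ω.1 + δ • ω.2.2.fst)) +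
          inner ℝ X.2.2 ((2 * Real.pi) • (t • ω.2.1 + δ • ω.2.2.snd))) *
        ((expI (-(2 * Real.pi * inner ℝ ω.1 κ)) * 𝓕 θ ω.1) *
          ((expI (-(2 * Real.pi * inner ℝ ω.2.1 κ')) * 𝓕 θ ω.2.1) * 𝓕 Φ ω.2.2)) := by
  rw [bumpTerm, schwartz_inversion θ, schwartz_inversion θ, schwartz_inversion Φ, mul_assoc,
    ← integral_prod_mul, ← integral_prod_mul]
  refine integral_congr_ae (.of_forall fun ω => ?_)
  simp only [inner_sub_right, inner_smul_right, inner_add_right, WithLp.prod_inner_apply, mul_sub,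
    mul_add, real_inner_comm X.2.1, real_inner_comm X.2.2, WithLp.ofLp_fst, WithLp.ofLp_snd]
  simp only [sub_eq_add_neg, expI_add]
  ring

/-- The decay of `lpPiece` in `k` costs moments of the Fourier transforms of `θ` and `Φ`, which are
finite. Translations only produce phases, so the bound is uniform in the centres `κ`, `κ'`. -/
lemma exists_norm_lpBlock_bumpTerm_le {n : ℕ} (φ : 𝓢(Rn n, ℂ)) (hφ : IsLPGenerator φ)
    (θ : 𝓢(Rn n, ℂ)) (Φ : 𝓢(WithLp 2 (Rn n × Rn n), ℂ)) (N : ℕ) (T : ℝ) (hT : 0 ≤ T) :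
    ∃ C : ℝ, 0 ≤ C ∧ ∀ (t δ : ℝ) (κ κ' : Rn n) (k : Fin 3 → ℕ) (X : Rn3 n), |t| ≤ T → |δ| ≤ T →
      ‖lpBlock φ k (bumpTerm θ Φ t δ κ κ') X‖ ≤ C * ((2 : ℝ) ^ ((∑ i, k i) * N))⁻¹ := by
  obtain ⟨D, hD0, hD⟩ := hφ.exists_lpPiece_decay N
  -- The moment for `Φ` has order `2N` because its frequency enters both the `ξ` and the `η`
  -- multiplier.
  set G : Rn n × Rn n × WithLp 2 (Rn n × Rn n) → ℝ := fun ω =>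
    ((1 + ‖ω.1‖) ^ N * ‖𝓕 θ ω.1‖) * (((1 + ‖ω.2.1‖) ^ N * ‖𝓕 θ ω.2.1‖) *
      ((1 + ‖ω.2.2‖) ^ (2 * N) * ‖𝓕 Φ ω.2.2‖)) with hG
  have hGi : Integrable G := (integrable_one_add_norm_pow_mul _ N).mul_prod
    ((integrable_one_add_norm_pow_mul _ N).mul_prod (integrable_one_add_norm_pow_mul _ (2 * N)))
  set S : ℝ := 1 + 2 * Real.pi * T
  have hS : 0 ≤ S := by positivity
  refine ⟨D ^ 3 * S ^ (2 * N) * ∫ ω, G ω, by positivity, fun t δ κ κ' k X ht hδ => ?_⟩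
  have hfun : bumpTerm θ Φ t δ κ κ' = fun X => _ :=
    funext fun X => bumpTerm_eq_superposition θ Φ t δ κ κ' X
  rw [hfun, lpBlock_superposition]
  rotate_left
  · have h1 : ∀ κ : Rn n, Integrable fun y => expI (-(2 * Real.pi * inner ℝ y κ)) * 𝓕 θ y :=
      fun κ => (𝓕 θ).integrable.bdd_mul (c := 1) (by fun_prop)
        (.of_forall fun _ => (norm_expI _).le)
    exact (h1 κ).mul_prod ((h1 κ').mul_prod (𝓕 Φ).integrable)
  · fun_prop
  · fun_prop
  have key : ∀ (y u : Rn n) (z : WithLp 2 (Rn n × Rn n)), ‖u‖ ≤ ‖z‖ →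
      1 + ‖(2 * Real.pi) • (t • y + δ • u)‖ ≤ S * ((1 + ‖y‖) * (1 + ‖z‖)) := fun y u z huz => by
    have h1 : ‖t • y + δ • u‖ ≤ T * ‖y‖ + T * ‖z‖ := by
      refine (norm_add_le _ _).trans ?_
      rw [norm_smul, norm_smul, Real.norm_eq_abs, Real.norm_eq_abs]
      gcongr
    rw [norm_smul, Real.norm_of_nonneg (by positivity)]
    calc 1 + 2 * Real.pi * ‖t • y + δ • u‖ ≤ 1 + 2 * Real.pi * (T * ‖y‖ + T * ‖z‖) := by gcongr
      _ = 1 + (2 * Real.pi * T) * (‖y‖ + ‖z‖) := by ring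
      _ ≤ (1 + 2 * Real.pi * T) * ((1 + ‖y‖) * (1 + ‖z‖)) := by
        have : 0 ≤ 2 * Real.pi * T := by positivity
        nlinarith [norm_nonneg y, norm_nonneg z, mul_nonneg (norm_nonneg y) (norm_nonneg z)]
  rw [show D ^ 3 * S ^ (2 * N) * (∫ ω, G ω) * ((2 : ℝ) ^ ((∑ i, k i) * N))⁻¹ =
    ∫ ω, (D ^ 3 * S ^ (2 * N) * ((2 : ℝ) ^ ((∑ i, k i) * N))⁻¹) * G ω by
      rw [integral_const_mul]; ring]
  refine norm_integral_le_of_norm_le (hGi.const_mul _) (.of_forall fun ω => ?_)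
  simp only [norm_mul, norm_expI, one_mul]
  have hf : ‖ω.2.2.fst‖ ≤ ‖ω.2.2‖ := WithLp.norm_fst_le _ _
  have hs : ‖ω.2.2.snd‖ ≤ ‖ω.2.2‖ := WithLp.norm_snd_le _ _
  have h0 := hD (k 0) 0
  have h1 := (hD (k 1) ((2 * Real.pi) • (t • ω.1 + δ • ω.2.2.fst))).trans
    (mul_le_mul_of_nonneg_left (pow_le_pow_left₀ (by positivity) (key _ _ _ hf) N) (by positivity))
  have h2 := (hD (k 2) ((2 * Real.pi) • (t • ω.2.1 + δ • ω.2.2.snd))).trans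
    (mul_le_mul_of_nonneg_left (pow_le_pow_left₀ (by positivity) (key _ _ _ hs) N) (by positivity))
  simp only [norm_zero, add_zero, one_pow, mul_one] at h0
  refine (mul_le_mul_of_nonneg_left (mul_le_mul (mul_le_mul h0 h1 (norm_nonneg _) (by positivity))
    h2 (norm_nonneg _) (by positivity)) (by positivity)).trans (le_of_eq ?_)
  simp only [hG, Fin.sum_univ_three, add_mul (k 0 + k 1), add_mul (k 0), pow_add, mul_pow, mul_inv, pow_mul]
  generalize 1 + ‖ω.1‖ = A
  generalize 1 + ‖ω.2.1‖ = B
  generalize 1 + ‖ω.2.2‖ = E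
  ring_nf

/-! ### Rudin-Shapiro polynomials -/

/-- Rudin-Shapiro recursion `(P, Q) ↦ (P + z^{2^M} Q, P - z^{2^M} Q)`; on the unit circle the
parallelogram law doubles `|P|² + |Q|²`. -/
lemma exists_rudinShapiro_pair (M : ℕ) : ∃ a b : ℕ → ℝ, (∀ k, |a k| = 1) ∧ (∀ k, |b k| = 1) ∧
    ∀ z : ℂ, ‖z‖ = 1 → ‖∑ k ∈ Finset.range (2 ^ M), (a k : ℂ) * z ^ k‖ ^ 2 +
      ‖∑ k ∈ Finset.range (2 ^ M), (b k : ℂ) * z ^ k‖ ^ 2 = 2 ^ (M + 1) := by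
  induction M with
  | zero => exact ⟨fun _ => 1, fun _ => 1, by simp, by simp, fun z _ => by norm_num⟩
  | succ M ih =>
    obtain ⟨a, b, ha, hb, hab⟩ := ih
    refine ⟨fun k => if k < 2 ^ M then a k else b (k - 2 ^ M),
      fun k => if k < 2 ^ M then a k else -b (k - 2 ^ M), fun k => ?_, fun k => ?_, fun z hz => ?_⟩
    · dsimp only
      split_ifs
      · exact ha k
      · exact hb _
    · dsimp only
      split_ifs
      · exact ha k
      · rw [abs_neg]
        exact hb _
    · have h1 : ∀ c : ℕ → ℝ, ∑ k ∈ Finset.range (2 ^ (M + 1)),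
          (((if k < 2 ^ M then a k else c (k - 2 ^ M) : ℝ)) : ℂ) * z ^ k =
          ∑ k ∈ Finset.range (2 ^ M), (a k : ℂ) * z ^ k +
            z ^ 2 ^ M * ∑ k ∈ Finset.range (2 ^ M), (c k : ℂ) * z ^ k := fun c => by
        rw [pow_succ 2 M, mul_two, Finset.sum_range_add, Finset.mul_sum]
        congr 1
        · refine Finset.sum_congr rfl fun k hk => ?_
          rw [if_pos (Finset.mem_range.1 hk)]
        · refine Finset.sum_congr rfl fun k _ => ?_
          rw [if_neg (by omega), Nat.add_sub_cancel_left, pow_add]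
          ring
      have h2 := h1 fun k => -b k
      simp only [Complex.ofReal_neg, neg_mul, Finset.sum_neg_distrib, mul_neg,
        ← sub_eq_add_neg] at h2
      rw [h1 b, h2]
      have h3 := parallelogram_law_with_norm ℝ
        (∑ k ∈ Finset.range (2 ^ M), (a k : ℂ) * z ^ k)
        (z ^ 2 ^ M * ∑ k ∈ Finset.range (2 ^ M), (b k : ℂ) * z ^ k)
      have h4 := hab z hz
      rw [norm_mul (z ^ 2 ^ M), norm_pow, hz, one_pow, one_mul] at h3
      rw [pow_succ 2 (M + 1)]
      linear_combination h3 + 2 * h4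

/-- The shift to `[2^M, 2^{M+1})` multiplies by a unimodular factor; it keeps the frequencies away
from the origin, so that pieces live in annuli. -/
lemma exists_rudinShapiro (M : ℕ) : ∃ a : ℕ → ℝ, (∀ k, |a k| = 1) ∧
    ∀ z : ℂ, ‖z‖ = 1 → ‖∑ k ∈ Finset.Ico (2 ^ M) (2 ^ (M + 1)), (a k : ℂ) * z ^ k‖ ≤
      √(2 ^ (M + 1)) := by
  obtain ⟨a, b, ha, -, hab⟩ := exists_rudinShapiro_pair M
  refine ⟨fun k => a (k - 2 ^ M), fun k => ha _, fun z hz => ?_⟩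
  rw [Finset.sum_Ico_eq_sum_range, show 2 ^ (M + 1) - 2 ^ M = 2 ^ M by rw [pow_succ]; omega]
  have h1 : ∑ k ∈ Finset.range (2 ^ M), (a (2 ^ M + k - 2 ^ M) : ℂ) * z ^ (2 ^ M + k) =
      z ^ 2 ^ M * ∑ k ∈ Finset.range (2 ^ M), (a k : ℂ) * z ^ k := by
    rw [Finset.mul_sum]
    refine Finset.sum_congr rfl fun k _ => ?_
    rw [Nat.add_sub_cancel_left, pow_add]
    ring
  rw [h1, norm_mul, norm_pow, hz, one_pow, one_mul]
  refine Real.le_sqrt_of_sq_le ?_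
  rw [← hab z hz]
  linarith [sq_nonneg ‖∑ k ∈ Finset.range (2 ^ M), (b k : ℂ) * z ^ k‖]

/-! ### Lattice boxes and flat polynomials in several variables -/

/-- The dyadic box `[2^M, 2^{M+1})ⁿ` of lattice points. -/
def box (n M : ℕ) : Finset (Fin n → ℕ) :=
  Fintype.piFinset fun _ => Finset.Ico (2 ^ M) (2 ^ (M + 1))

lemma card_box (n M : ℕ) : (box n M).card = 2 ^ (M * n) := by
  rw [box, Fintype.card_piFinset]
  simp only [Nat.card_Ico, Finset.prod_const, Finset.card_univ, Fintype.card_fin, pow_succ, mul_two,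
    Nat.add_sub_cancel, pow_mul]

lemma mem_box {n M : ℕ} {κ : Fin n → ℕ} :
    κ ∈ box n M ↔ ∀ i, 2 ^ M ≤ κ i ∧ κ i < 2 ^ (M + 1) := by
  simp [box, Fintype.mem_piFinset]

/-- All output frequencies fall in one box, so a single flat polynomial tests them all. -/
lemma add_mem_box {n M : ℕ} {κ κ' : Fin n → ℕ} (h : κ ∈ box n M) (h' : κ' ∈ box n M) :
    κ + κ' ∈ box n (M + 1) := by
  rw [mem_box] at *
  intro i
  have := h i
  have := h' i
  simp only [pow_succ, Pi.add_apply] at *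
  omega

/-- A lattice point with natural coordinates, as a vector of `ℝⁿ`. -/
def natVec {n : ℕ} (κ : Fin n → ℕ) : Rn n := WithLp.toLp 2 fun i => (κ i : ℝ)

@[simp] lemma natVec_apply {n : ℕ} (κ : Fin n → ℕ) (i : Fin n) : natVec κ i = κ i := rfl

lemma natVec_add {n : ℕ} (κ κ' : Fin n → ℕ) : natVec (κ + κ') = natVec κ + natVec κ' := by
  ext i
  simp

lemma one_le_norm_natVec_sub {n : ℕ} {κ κ' : Fin n → ℕ} (h : κ ≠ κ') :
    1 ≤ ‖natVec κ - natVec κ'‖ := by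
  obtain ⟨i, hi⟩ := Function.ne_iff.1 h
  refine le_trans ?_ (PiLp.norm_apply_le _ i)
  have h1 : ((1 : ℤ) : ℝ) ≤ |((κ i : ℤ) : ℝ) - ((κ' i : ℤ) : ℝ)| := by
    rw [← Int.cast_sub, ← Int.cast_abs, Int.cast_le]
    exact Int.one_le_abs (by omega)
  simpa using h1

/-- Flat trigonometric polynomials with unimodular coefficients on a dyadic box. -/
lemma exists_flat_trigPoly (n M : ℕ) : ∃ A : (Fin n → ℕ) → ℝ, (∀ κ, |A κ| = 1) ∧
    ∀ y : Rn n, ‖∑ κ ∈ box n M, (A κ : ℂ) * expI (inner ℝ y (natVec κ))‖ ≤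
      √(2 ^ (M + 1)) ^ n := by
  obtain ⟨a, ha, hb⟩ := exists_rudinShapiro M
  refine ⟨fun κ => ∏ i, a (κ i), fun κ => ?_, fun y => ?_⟩
  · rw [Finset.abs_prod]
    simp [ha]
  · have h1 : ∑ κ ∈ box n M, ((∏ i, a (κ i) : ℝ) : ℂ) * expI (inner ℝ y (natVec κ)) =
        ∏ i, ∑ k ∈ Finset.Ico (2 ^ M) (2 ^ (M + 1)), (a k : ℂ) * expI (y i) ^ k := by
      rw [Finset.prod_univ_sum]
      refine Finset.sum_congr rfl fun κ _ => ?_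
      rw [PiLp.inner_apply, expI_sum, Complex.ofReal_prod, ← Finset.prod_mul_distrib]
      refine Finset.prod_congr rfl fun i _ => ?_
      rw [← expI_nat_mul]
      rfl
    rw [h1, norm_prod]
    calc _ ≤ ∏ i : Fin n, √(2 ^ (M + 1)) :=
        Finset.prod_le_prod (fun _ _ => norm_nonneg _) fun i _ => hb _ (norm_expI _)
      _ = _ := by simp

/-! ### Bump functions -/

lemma exists_schwartz_bump (V : Type*) [NormedAddCommGroup V] [InnerProductSpace ℝ V]
    [FiniteDimensional ℝ V] {r R : ℝ} (hr : 0 < r) (hrR : r < R) :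
    ∃ θ : 𝓢(V, ℂ), (∀ x, ‖x‖ ≤ r → θ x = 1) ∧ (∀ x, R ≤ ‖x‖ → θ x = 0) ∧
      ∀ x, ∃ c : ℝ, 0 ≤ c ∧ c ≤ 1 ∧ θ x = c := by
  let b : ContDiffBump (0 : V) := ⟨r, R, hr, hrR⟩
  have hs : HasCompactSupport fun x => ((b x : ℝ) : ℂ) :=
    b.hasCompactSupport.comp_left (g := fun t : ℝ => (t : ℂ)) Complex.ofReal_zero
  have hd : ContDiff ℝ ((⊤ : ℕ∞) : WithTop ℕ∞) fun x => ((b x : ℝ) : ℂ) := Complex.ofRealCLM.contDiff.comp b.contDiff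
  refine ⟨hs.toSchwartzMap hd, fun x hx => ?_, fun x hx => ?_,
    fun x => ⟨b x, b.nonneg, b.le_one, rfl⟩⟩
  · change ((b x : ℝ) : ℂ) = 1
    rw [b.one_of_mem_closedBall (by simpa using hx), Complex.ofReal_one]
  · change ((b x : ℝ) : ℂ) = 0
    rw [b.zero_of_le_dist (by simpa using hx), Complex.ofReal_zero]

/-! ### The pieces of the symbol -/

/-- A Schwartz bump with values in the closed unit disc, equal to `1` near the origin and supported
in the ball of radius `1/4`. -/
structure IsBump {n : ℕ} (θ : 𝓢(Rn n, ℂ)) : Prop where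
  eq_one : ∀ x, ‖x‖ ≤ 1 / 8 → θ x = 1
  eq_zero : ∀ x, 1 / 4 ≤ ‖x‖ → θ x = 0
  norm_le_one : ∀ x, ‖θ x‖ ≤ 1

lemma exists_isBump (n : ℕ) : ∃ θ : 𝓢(Rn n, ℂ), IsBump θ := by
  obtain ⟨θ, h1, h2, h3⟩ := exists_schwartz_bump (Rn n) (r := 1 / 8) (R := 1 / 4)
    (by norm_num) (by norm_num)
  refine ⟨θ, h1, h2, fun x => ?_⟩
  obtain ⟨c, hc0, hc1, hc⟩ := h3 x
  rw [hc, Complex.norm_real, Real.norm_of_nonneg hc0]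
  exact hc1

/-- Distinct lattice points are at distance at least `1 = 3/4 + 1/4`, and `1/4` is the support
radius of `θ`. -/
lemma IsBump.eq_zero_of_ne {n : ℕ} {θ : 𝓢(Rn n, ℂ)} (hθ : IsBump θ) {v : Rn n}
    {κ κ' : Fin n → ℕ} (h : ‖v - natVec κ‖ ≤ 3 / 4) (hne : κ' ≠ κ) : θ (v - natVec κ') = 0 := by
  refine hθ.eq_zero _ ?_
  have h1 := one_le_norm_natVec_sub hne
  have h2 : ‖natVec κ' - natVec κ‖ ≤ ‖v - natVec κ‖ + ‖v - natVec κ'‖ := by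
    rw [show natVec κ' - natVec κ = (v - natVec κ) - (v - natVec κ') by abel]
    exact norm_sub_le _ _
  linarith

lemma IsBump.sum_norm_le_one {n : ℕ} {θ : 𝓢(Rn n, ℂ)} (hθ : IsBump θ) (s : Finset (Fin n → ℕ))
    (v : Rn n) : ∑ κ ∈ s, ‖θ (v - natVec κ)‖ ≤ 1 := by
  by_cases h : ∃ κ ∈ s, θ (v - natVec κ) ≠ 0
  · obtain ⟨κ, hκ, h0⟩ := h
    have h1 : ‖v - natVec κ‖ ≤ 3 / 4 := by
      by_contra h2
      exact h0 (hθ.eq_zero _ (by linarith))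
    rw [Finset.sum_eq_single_of_mem κ hκ fun κ' _ hne => by rw [hθ.eq_zero_of_ne h1 hne, norm_zero]]
    exact hθ.norm_le_one _
  · push Not at h
    rw [Finset.sum_eq_zero fun κ hκ => by rw [h κ hκ, norm_zero]]
    exact zero_le_one

/-- The sum of bumps centred at the points of `l • box n M` in both variables. -/
def symPiece {n : ℕ} (θ : 𝓢(Rn n, ℂ)) (c : (Fin n → ℕ) × (Fin n → ℕ) → ℂ) (M : ℕ) (l : ℝ)
    (ξ η : Rn n) : ℂ :=
  ∑ p ∈ box n M ×ˢ box n M, c p * (θ (l⁻¹ • ξ - natVec p.1) * θ (l⁻¹ • η - natVec p.2))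

lemma continuous_symPiece {n : ℕ} (θ : 𝓢(Rn n, ℂ)) (c : (Fin n → ℕ) × (Fin n → ℕ) → ℂ) (M : ℕ)
    (l : ℝ) : Continuous fun X : Rn3 n => symPiece θ c M l X.2.1 X.2.2 := by
  have := θ.continuous
  unfold symPiece
  fun_prop

lemma norm_symPiece_le {n : ℕ} {θ : 𝓢(Rn n, ℂ)} (hθ : IsBump θ)
    {c : (Fin n → ℕ) × (Fin n → ℕ) → ℂ} (hc : ∀ p, ‖c p‖ ≤ 1) (M : ℕ) (l : ℝ) (ξ η : Rn n) :
    ‖symPiece θ c M l ξ η‖ ≤ 1 := by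
  calc ‖symPiece θ c M l ξ η‖ ≤ ∑ p ∈ box n M ×ˢ box n M,
        ‖θ (l⁻¹ • ξ - natVec p.1)‖ * ‖θ (l⁻¹ • η - natVec p.2)‖ := by
        refine norm_sum_le_of_le _ fun p _ => ?_
        rw [norm_mul, norm_mul]
        exact mul_le_of_le_one_left (by positivity) (hc p)
    _ = (∑ κ ∈ box n M, ‖θ (l⁻¹ • ξ - natVec κ)‖) * ∑ κ ∈ box n M, ‖θ (l⁻¹ • η - natVec κ)‖ := by
        rw [Finset.sum_mul_sum, Finset.sum_product]
    _ ≤ 1 * 1 := by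
        gcongr
        · exact hθ.sum_norm_le_one _ _
        · exact hθ.sum_norm_le_one _ _
    _ = 1 := one_mul 1

lemma norm_natVec_le {n M : ℕ} {κ : Fin n → ℕ} (h : κ ∈ box n M) :
    ‖natVec κ‖ ≤ n * 2 ^ (M + 1) := by
  have h1 : ∀ i, ‖natVec κ i‖ ≤ 2 ^ (M + 1) := fun i => by
    rw [natVec_apply, Real.norm_natCast]
    exact_mod_cast (mem_box.1 h i).2.le
  have h2 : natVec κ = ∑ i, EuclideanSpace.single i (natVec κ i) := by
    ext j
    simp
  rw [h2]
  calc _ ≤ ∑ _i : Fin n, (2 : ℝ) ^ (M + 1) := norm_sum_le_of_le _ fun i _ => by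
        rw [EuclideanSpace.single, PiLp.norm_single]
        exact h1 i
    _ = _ := by simp

lemma le_norm_natVec {n M : ℕ} (hn : 0 < n) {κ : Fin n → ℕ} (h : κ ∈ box n M) :
    2 ^ M ≤ ‖natVec κ‖ := by
  refine le_trans ?_ (PiLp.norm_apply_le _ ⟨0, hn⟩)
  rw [natVec_apply, Real.norm_natCast]
  exact_mod_cast (mem_box.1 h _).1

/-- Each variable of a bump piece lives in an annulus. -/
lemma norm_bounds_of_bump_ne_zero {n M : ℕ} (hn : 0 < n) {θ : 𝓢(Rn n, ℂ)} (hθ : IsBump θ)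
    {κ : Fin n → ℕ} (hκ : κ ∈ box n M) {l : ℝ} (hl : 0 < l) {ξ : Rn n}
    (h : θ (l⁻¹ • ξ - natVec κ) ≠ 0) :
    l * 2 ^ M ≤ 2 * ‖ξ‖ ∧ ‖ξ‖ ≤ 2 ^ (n + 1) * (l * 2 ^ M) := by
  have h1 : ‖l⁻¹ • ξ - natVec κ‖ ≤ 1 / 4 := by
    by_contra h2
    exact h (hθ.eq_zero _ (by linarith))
  have h2 := le_norm_natVec hn hκ
  have h3 := norm_natVec_le hκ
  have h4 : ‖l⁻¹ • ξ‖ = ‖ξ‖ / l := by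
    rw [norm_smul, Real.norm_of_nonneg (by positivity), inv_mul_eq_div]
  have h5 : (1 : ℝ) ≤ 2 ^ M := one_le_pow₀ (by norm_num)
  have h6 : ‖ξ‖ = l * ‖l⁻¹ • ξ‖ := by rw [h4]; field_simp
  have h7 : ‖natVec κ‖ ≤ ‖l⁻¹ • ξ‖ + ‖l⁻¹ • ξ - natVec κ‖ := by
    have := norm_sub_le (l⁻¹ • ξ) (l⁻¹ • ξ - natVec κ)
    rwa [sub_sub_cancel] at this
  have h8 : ‖l⁻¹ • ξ‖ ≤ ‖l⁻¹ • ξ - natVec κ‖ + ‖natVec κ‖ := by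
    have := norm_add_le (l⁻¹ • ξ - natVec κ) (natVec κ)
    rwa [sub_add_cancel] at this
  have h9 : ((n : ℝ) + 1) ≤ 2 ^ n := by
    exact_mod_cast Nat.lt_two_pow_self (n := n)
  rw [h6]
  constructor
  · calc l * 2 ^ M ≤ l * (2 * ‖l⁻¹ • ξ‖) := by gcongr; linarith
      _ = _ := by ring
  · calc l * ‖l⁻¹ • ξ‖ ≤ l * (2 ^ (n + 1) * 2 ^ M) := by
          gcongr
          rw [pow_succ] at *
          nlinarith
      _ = _ := by ring

lemma norm_bounds_of_symPiece_ne_zero {n M : ℕ} (hn : 0 < n) {θ : 𝓢(Rn n, ℂ)} (hθ : IsBump θ)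
    {c : (Fin n → ℕ) × (Fin n → ℕ) → ℂ} {l : ℝ} (hl : 0 < l) {ξ η : Rn n}
    (h : symPiece θ c M l ξ η ≠ 0) :
    (l * 2 ^ M ≤ 2 * ‖ξ‖ ∧ ‖ξ‖ ≤ 2 ^ (n + 1) * (l * 2 ^ M)) ∧
      (l * 2 ^ M ≤ 2 * ‖η‖ ∧ ‖η‖ ≤ 2 ^ (n + 1) * (l * 2 ^ M)) := by
  obtain ⟨p, hp, hp0⟩ := Finset.exists_ne_zero_of_sum_ne_zero h
  rw [Finset.mem_product] at hp
  have h1 := right_ne_zero_of_mul hp0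
  exact ⟨norm_bounds_of_bump_ne_zero hn hθ hp.1 hl (left_ne_zero_of_mul h1),
    norm_bounds_of_bump_ne_zero hn hθ hp.2 hl (right_ne_zero_of_mul h1)⟩

/-! ### Scales and the lacunary symbol -/

/-- The spacing `2^{Jρ}` of the bumps at frequency `2^J`. -/
def spacing (ρ : ℝ) (J : ℕ) : ℝ := (2 : ℝ) ^ ((J : ℝ) * ρ)

/-- The number of bumps at frequency `2^J` is `2^{gridExp ρ J}` in each direction. -/
def gridExp (ρ : ℝ) (J : ℕ) : ℕ := ⌊(J : ℝ) * (1 - ρ)⌋₊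

lemma spacing_pos (ρ : ℝ) (J : ℕ) : 0 < spacing ρ J := by unfold spacing; positivity

lemma one_le_spacing {ρ : ℝ} (hρ : 0 ≤ ρ) (J : ℕ) : 1 ≤ spacing ρ J :=
  Real.one_le_rpow (by norm_num) (by positivity)

lemma two_pow_gridExp_le {ρ : ℝ} (hρ : ρ < 1) (J : ℕ) :
    (2 : ℝ) ^ gridExp ρ J ≤ (2 : ℝ) ^ ((J : ℝ) * (1 - ρ)) := by
  rw [← Real.rpow_natCast]
  refine Real.rpow_le_rpow_of_exponent_le (by norm_num) (Nat.floor_le ?_)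
  have : 0 ≤ 1 - ρ := by linarith
  positivity

lemma le_two_pow_gridExp (ρ : ℝ) (J : ℕ) :
    (2 : ℝ) ^ ((J : ℝ) * (1 - ρ)) ≤ 2 * (2 : ℝ) ^ gridExp ρ J := by
  rw [← pow_succ', ← Real.rpow_natCast]
  refine Real.rpow_le_rpow_of_exponent_le (by norm_num) ?_
  push_cast
  exact (Nat.lt_floor_add_one _).le

lemma spacing_mul (ρ : ℝ) (J : ℕ) : spacing ρ J * (2 : ℝ) ^ ((J : ℝ) * (1 - ρ)) = 2 ^ J := by
  rw [spacing, ← Real.rpow_add (by norm_num), ← Real.rpow_natCast]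
  congr 1
  ring

lemma spacing_mul_le {ρ : ℝ} (hρ : ρ < 1) (J : ℕ) : spacing ρ J * 2 ^ gridExp ρ J ≤ 2 ^ J := by
  rw [← spacing_mul ρ J]
  exact mul_le_mul_of_nonneg_left (two_pow_gridExp_le hρ J) (spacing_pos ρ J).le

lemma le_spacing_mul (ρ : ℝ) (J : ℕ) : 2 ^ J ≤ 2 * (spacing ρ J * 2 ^ gridExp ρ J) := by
  rw [← spacing_mul ρ J]
  calc _ ≤ spacing ρ J * (2 * 2 ^ gridExp ρ J) :=
        mul_le_mul_of_nonneg_left (le_two_pow_gridExp ρ J) (spacing_pos ρ J).le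
    _ = _ := by ring

/-- The piece of the symbol at frequency `2^J`. -/
def dyadicPiece {n : ℕ} (θ : 𝓢(Rn n, ℂ)) (c : (Fin n → ℕ) × (Fin n → ℕ) → ℂ) (ρ : ℝ) (J : ℕ)
    (ξ η : Rn n) : ℂ :=
  symPiece θ c (gridExp ρ J) (spacing ρ J) ξ η

lemma norm_bounds_of_dyadicPiece_ne_zero {n : ℕ} (hn : 0 < n) {θ : 𝓢(Rn n, ℂ)} (hθ : IsBump θ)
    {c : (Fin n → ℕ) × (Fin n → ℕ) → ℂ} {ρ : ℝ} (hρ : ρ < 1) {J : ℕ} {ξ η : Rn n}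
    (h : dyadicPiece θ c ρ J ξ η ≠ 0) :
    2 ^ J ≤ 4 * ‖ξ‖ ∧ ‖ξ‖ ≤ 2 ^ (J + n + 1) ∧ ‖η‖ ≤ 2 ^ (J + n + 1) := by
  obtain ⟨⟨h1, h2⟩, -, h3⟩ := norm_bounds_of_symPiece_ne_zero hn hθ (spacing_pos ρ J) h
  have h4 := le_spacing_mul ρ J
  have h5 : (2 : ℝ) ^ (n + 1) * (spacing ρ J * 2 ^ gridExp ρ J) ≤ 2 ^ (J + n + 1) := by
    rw [add_assoc, pow_add 2 J, mul_comm ((2 : ℝ) ^ J)]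
    exact mul_le_mul_of_nonneg_left (spacing_mul_le hρ J) (by positivity)
  exact ⟨by linarith, h2.trans h5, h3.trans h5⟩

/-- The gap between consecutive frequency exponents in the symbol. -/
def gap (n : ℕ) : ℕ := n + 7

/-- The lacunary sum of dyadic pieces of order `m`. -/
def lacunarySymbol {n : ℕ} (θ : 𝓢(Rn n, ℂ)) (c : ℕ → (Fin n → ℕ) × (Fin n → ℕ) → ℂ) (ρ m : ℝ)
    (X : Rn3 n) : ℂ :=
  ∑' i : ℕ, (((2 : ℝ) ^ (((gap n * i : ℕ) : ℝ) * m) : ℝ) : ℂ) *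
    dyadicPiece θ (c i) ρ (gap n * i) X.2.1 X.2.2

/-- The annuli `2^J/4 ≤ ‖ξ‖ ≤ 2^{J+n+1}` for different multiples `J` of `gap n` are disjoint; the
variable `ξ` alone separates the pieces. -/
lemma dyadicPiece_disjoint {n : ℕ} (hn : 0 < n) {θ : 𝓢(Rn n, ℂ)} (hθ : IsBump θ)
    {c c' : (Fin n → ℕ) × (Fin n → ℕ) → ℂ} {ρ : ℝ} (hρ : ρ < 1) {i i' : ℕ} (hii : i ≠ i')
    {ξ η η' : Rn n} (h : dyadicPiece θ c ρ (gap n * i) ξ η ≠ 0) :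
    dyadicPiece θ c' ρ (gap n * i') ξ η' = 0 := by
  by_contra h'
  obtain ⟨a1, a2, -⟩ := norm_bounds_of_dyadicPiece_ne_zero hn hθ hρ h
  obtain ⟨b1, b2, -⟩ := norm_bounds_of_dyadicPiece_ne_zero hn hθ hρ h'
  have key : ∀ {i i' : ℕ}, (2 : ℝ) ^ (gap n * i) ≤ 4 * ‖ξ‖ → ‖ξ‖ ≤ 2 ^ (gap n * i' + n + 1) →
      i ≤ i' := fun {i i'} u v => by
    by_contra hlt
    have h1 : gap n * (i' + 1) ≤ gap n * i := Nat.mul_le_mul_left _ (by omega)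
    have h2 : (2 : ℝ) ^ (gap n * i' + n + 4) ≤ 2 ^ (gap n * i) :=
      pow_le_pow_right₀ (by norm_num) (by rw [mul_add] at h1; unfold gap at *; omega)
    have h3 : (2 : ℝ) ^ (gap n * i' + n + 4) = 8 * 2 ^ (gap n * i' + n + 1) := by ring
    have h4 : (0 : ℝ) < 2 ^ (gap n * i' + n + 1) := by positivity
    linarith
  exact hii (le_antisymm (key a1 b2) (key b1 a2))

lemma lacunarySymbol_eq_of_ne_zero {n : ℕ} (hn : 0 < n) {θ : 𝓢(Rn n, ℂ)} (hθ : IsBump θ)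
    (c : ℕ → (Fin n → ℕ) × (Fin n → ℕ) → ℂ) {ρ : ℝ} (hρ : ρ < 1) (m : ℝ) {i : ℕ} {X : Rn3 n}
    (h : dyadicPiece θ (c i) ρ (gap n * i) X.2.1 X.2.2 ≠ 0) :
    lacunarySymbol θ c ρ m X = (((2 : ℝ) ^ (((gap n * i : ℕ) : ℝ) * m) : ℝ) : ℂ) *
      dyadicPiece θ (c i) ρ (gap n * i) X.2.1 X.2.2 :=
  tsum_eq_single i fun i' hi' => by
    rw [dyadicPiece_disjoint hn hθ hρ hi'.symm h, mul_zero]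

lemma norm_lacunarySymbol_le {n : ℕ} (hn : 0 < n) {θ : 𝓢(Rn n, ℂ)} (hθ : IsBump θ)
    {c : ℕ → (Fin n → ℕ) × (Fin n → ℕ) → ℂ} (hc : ∀ i p, ‖c i p‖ ≤ 1) {ρ : ℝ} (hρ : ρ < 1)
    {m : ℝ} (hm : m ≤ 0) (X : Rn3 n) : ‖lacunarySymbol θ c ρ m X‖ ≤ 1 := by
  by_cases h : ∃ i, dyadicPiece θ (c i) ρ (gap n * i) X.2.1 X.2.2 ≠ 0
  · obtain ⟨i, hi⟩ := h
    rw [lacunarySymbol_eq_of_ne_zero hn hθ c hρ m hi, norm_mul, Complex.norm_real,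
      Real.norm_of_nonneg (by positivity)]
    have h1 : (2 : ℝ) ^ (((gap n * i : ℕ) : ℝ) * m) ≤ 1 :=
      Real.rpow_le_one_of_one_le_of_nonpos (by norm_num)
        (mul_nonpos_of_nonneg_of_nonpos (by positivity) hm)
    exact mul_le_one₀ h1 (norm_nonneg _) (norm_symPiece_le hθ (hc i) _ _ _ _)
  · push Not at h
    simp [lacunarySymbol, h]

lemma measurable_lacunarySymbol {n : ℕ} (hn : 0 < n) {θ : 𝓢(Rn n, ℂ)} (hθ : IsBump θ)
    (c : ℕ → (Fin n → ℕ) × (Fin n → ℕ) → ℂ) {ρ : ℝ} (hρ : ρ < 1) (m : ℝ) :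
    Measurable (lacunarySymbol θ c ρ m) := by
  set F : ℕ → Rn3 n → ℂ := fun i X => (((2 : ℝ) ^ (((gap n * i : ℕ) : ℝ) * m) : ℝ) : ℂ) *
    dyadicPiece θ (c i) ρ (gap n * i) X.2.1 X.2.2 with hF
  have hFm : ∀ i, Measurable (F i) := fun i =>
    (continuous_const.mul (continuous_symPiece θ (c i) _ _)).measurable
  have hs : ∀ X, Summable fun i => F i X := fun X => by
    by_cases h : ∃ i, dyadicPiece θ (c i) ρ (gap n * i) X.2.1 X.2.2 ≠ 0
    · obtain ⟨i, hi⟩ := h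
      exact (hasSum_single i fun i' hi' => by
        rw [hF]
        simp only
        rw [dyadicPiece_disjoint hn hθ hρ hi'.symm hi, mul_zero]).summable
    · push Not at h
      simp only [hF, h, mul_zero]
      exact summable_zero
  refine measurable_of_tendsto_metrizable (f := fun N X => ∑ i ∈ Finset.range N, F i X)
    (fun N => Finset.measurable_sum _ fun i _ => hFm i) ?_
  exact tendsto_pi_nhds.2 fun X => (hs X).hasSum.tendsto_sum_nat

lemma memLp_lacunarySymbol {n : ℕ} (hn : 0 < n) {θ : 𝓢(Rn n, ℂ)} (hθ : IsBump θ)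
    {c : ℕ → (Fin n → ℕ) × (Fin n → ℕ) → ℂ} (hc : ∀ i p, ‖c i p‖ ≤ 1) {ρ : ℝ} (hρ : ρ < 1)
    {m : ℝ} (hm : m ≤ 0) : MemLp (lacunarySymbol θ c ρ m) ∞ volume :=
  memLp_top_of_bound (measurable_lacunarySymbol hn hθ c hρ m).aestronglyMeasurable 1
    (.of_forall (norm_lacunarySymbol_le hn hθ hc hρ hm))

/-! ### Membership of the lacunary symbol in the symbol class -/

/-- The only frequency exponent of the lacunary symbol seen by `Ψ_j`. -/
def nearExp (n j : ℕ) : ℕ := gap n * ((j + 3) / gap n)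

lemma nearExp_le (n j : ℕ) : nearExp n j ≤ j + 3 := Nat.mul_div_le _ _

lemma le_nearExp (n j : ℕ) : j ≤ nearExp n j + n + 3 := by
  have h := Nat.lt_mul_div_succ (j + 3) (show 0 < gap n by unfold gap; omega)
  rw [mul_add] at h
  unfold nearExp
  have : gap n = n + 7 := rfl
  omega

/-- Comparison of supports. The surviving window `j - n - 3 ≤ J ≤ j + 3` contains `n + 7`
consecutive integers, hence exactly one multiple of `gap n`, namely `nearExp n j` when it is
nonnegative; this explains the value of `gap`. -/
lemma dyadicPiece_mul_lpPiece_eq_zero {n : ℕ} (hn : 0 < n) {θ : 𝓢(Rn n, ℂ)} (hθ : IsBump θ)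
    {Φ : 𝓢(WithLp 2 (Rn n × Rn n), ℂ)} (hΦ : IsLPGenerator Φ)
    (c : (Fin n → ℕ) × (Fin n → ℕ) → ℂ) {ρ : ℝ} (hρ : ρ < 1) {J j : ℕ}
    (h : j + 3 < J ∨ J + n + 3 < j) (ξ η : Rn n) :
    dyadicPiece θ c ρ J ξ η * lpPiece Φ j (WithLp.toLp 2 (ξ, η)) = 0 := by
  by_contra hne
  obtain ⟨h1, h2, h3⟩ := norm_bounds_of_dyadicPiece_ne_zero hn hθ hρ (left_ne_zero_of_mul hne)
  set Z : WithLp 2 (Rn n × Rn n) := WithLp.toLp 2 (ξ, η)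
  have hZ1 : ‖ξ‖ ≤ ‖Z‖ := WithLp.norm_fst_le _ Z
  have hZ2 : ‖Z‖ ≤ ‖ξ‖ + ‖η‖ := by
    have h4 := WithLp.prod_norm_sq_eq_of_L2 Z
    have h5 : ‖Z‖ ^ 2 ≤ (‖ξ‖ + ‖η‖) ^ 2 := by
      rw [h4]
      change ‖ξ‖ ^ 2 + ‖η‖ ^ 2 ≤ _
      nlinarith [norm_nonneg ξ, norm_nonneg η]
    exact (pow_le_pow_iff_left₀ (norm_nonneg _) (by positivity) two_ne_zero).1 h5
  rcases h with h | h
  · refine right_ne_zero_of_mul hne (hΦ.lpPiece_eq_zero_of_gt ?_)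
    have h4 : (2 : ℝ) ^ (j + 4) ≤ 2 ^ J := pow_le_pow_right₀ (by norm_num) (by omega)
    have h5 : (2 : ℝ) ^ (j + 4) = 16 * 2 ^ j := by ring
    have h6 : (0 : ℝ) < 2 ^ j := by positivity
    linarith
  · refine right_ne_zero_of_mul hne (hΦ.lpPiece_eq_zero_of_lt ?_ (by omega))
    have h4 : (2 : ℝ) ^ (J + n + 4) ≤ 2 ^ j := pow_le_pow_right₀ (by norm_num) (by omega)
    have h5 : (2 : ℝ) ^ (J + n + 4) = 8 * 2 ^ (J + n + 1) := by ring
    have h6 : (2 : ℝ) ^ (J + n + 1) > 0 := by positivity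
    linarith

lemma rescaledSymbol_lacunarySymbol {n : ℕ} (hn : 0 < n) {θ : 𝓢(Rn n, ℂ)} (hθ : IsBump θ)
    {Φ : 𝓢(WithLp 2 (Rn n × Rn n), ℂ)} (hΦ : IsLPGenerator Φ)
    (c : ℕ → (Fin n → ℕ) × (Fin n → ℕ) → ℂ) {ρ : ℝ} (hρ : ρ < 1) (m : ℝ) (j : ℕ) (X : Rn3 n) :
    rescaledSymbol Φ ρ (lacunarySymbol θ c ρ m) j X =
      (((2 : ℝ) ^ ((nearExp n j : ℝ) * m) : ℝ) : ℂ) *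
        (dyadicPiece θ (c ((j + 3) / gap n)) ρ (nearExp n j) (spacing ρ j • X.2.1)
          (spacing ρ j • X.2.2) *
        lpPiece Φ j (WithLp.toLp 2 (spacing ρ j • X.2.1, spacing ρ j • X.2.2))) := by
  have hg : gap n = n + 7 := rfl
  rw [rescaledSymbol, lacunarySymbol, ← tsum_mul_right]
  change ∑' i, _ * lpPiece Φ j (WithLp.toLp 2 (spacing ρ j • X.2.1, spacing ρ j • X.2.2)) = _
  rw [tsum_eq_single ((j + 3) / gap n), mul_assoc]
  · rfl
  · intro i hi
    rw [mul_assoc]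
    refine mul_eq_zero_of_right _ (dyadicPiece_mul_lpPiece_eq_zero hn hθ hΦ _ hρ ?_ _ _)
    have h1 := le_nearExp n j
    have h2 := Nat.lt_mul_div_succ (j + 3) (show 0 < gap n by omega)
    rcases lt_or_gt_of_ne hi with h | h
    · right
      have h3 : gap n * (i + 1) ≤ gap n * ((j + 3) / gap n) := Nat.mul_le_mul_left _ h
      have h4 := nearExp_le n j
      unfold nearExp at h4
      rw [mul_add] at h3
      omega
    · left
      have h3 : gap n * ((j + 3) / gap n + 1) ≤ gap n * i := Nat.mul_le_mul_left _ h
      omega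

/-- Since `2^{-j} 2^{jρ} ≤ 1`, the rescaled cutoff consists of at most two dilates of `Φ` with
factors bounded in `j`. For `j = 0` the second one is padding with coefficient zero. -/
lemma exists_lpPiece_smul {V : Type*} [NormedAddCommGroup V] [InnerProductSpace ℝ V]
    (Φ : 𝓢(V, ℂ)) {ρ : ℝ} (hρ : ρ < 1) (j : ℕ) :
    ∃ (e : Fin 2 → ℂ) (δ : Fin 2 → ℝ), (∀ b, ‖e b‖ ≤ 1) ∧ (∀ b, |δ b| ≤ 2) ∧
      ∀ Z : V, lpPiece Φ j (spacing ρ j • Z) = ∑ b, e b * Φ (δ b • Z) := by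
  rcases eq_or_ne j 0 with rfl | hj
  · refine ⟨![1, 0], ![1, 1], ?_, ?_, fun Z => ?_⟩
    · simp [Fin.forall_fin_two]
    · simp [Fin.forall_fin_two]
    · simp [lpPiece, spacing]
  · have h1 : ((2 : ℝ) ^ j)⁻¹ * spacing ρ j ≤ 1 := by
      rw [inv_mul_le_iff₀ (by positivity), mul_one, spacing, ← Real.rpow_natCast]
      exact Real.rpow_le_rpow_of_exponent_le (by norm_num)
        (mul_le_of_le_one_right (by positivity) hρ.le)
    have h2 : 0 ≤ ((2 : ℝ) ^ j)⁻¹ * spacing ρ j := by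
      have := spacing_pos ρ j
      positivity
    refine ⟨![1, -1], ![((2 : ℝ) ^ j)⁻¹ * spacing ρ j, 2 * (((2 : ℝ) ^ j)⁻¹ * spacing ρ j)],
      ?_, ?_, fun Z => ?_⟩
    · simp [Fin.forall_fin_two]
    · rw [Fin.forall_fin_two]
      simp only [Matrix.cons_val_zero, Matrix.cons_val_one]
      rw [abs_of_nonneg h2, abs_of_nonneg (by linarith)]
      constructor <;> linarith
    · simp [lpPiece, hj, mul_smul, sub_eq_add_neg]

/-- Rapid decay of the frequency blocks, up to a polynomial loss in the number of bumps. -/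
lemma exists_norm_lpBlock_rescaled_decay {n : ℕ} (hn : 0 < n) (φ : 𝓢(Rn n, ℂ))
    (hφ : IsLPGenerator φ) {θ : 𝓢(Rn n, ℂ)} (hθ : IsBump θ)
    {Φ : 𝓢(WithLp 2 (Rn n × Rn n), ℂ)} (hΦ : IsLPGenerator Φ)
    {c : ℕ → (Fin n → ℕ) × (Fin n → ℕ) → ℂ} (hc : ∀ i p, ‖c i p‖ ≤ 1) {ρ : ℝ} (hρ0 : 0 ≤ ρ)
    (hρ : ρ < 1) (m : ℝ) (N : ℕ) :
    ∃ C : ℝ, 0 ≤ C ∧ ∀ (j : ℕ) (k : Fin 3 → ℕ) (X : Rn3 n),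
      ‖lpBlock φ k (rescaledSymbol Φ ρ (lacunarySymbol θ c ρ m) j) X‖ ≤
        C * (2 : ℝ) ^ ((nearExp n j : ℝ) * m) *
          ((2 : ℝ) ^ (2 * n * gridExp ρ (nearExp n j)) * ((2 : ℝ) ^ ((∑ i, k i) * N))⁻¹) := by
  obtain ⟨C, hC0, hC⟩ := exists_norm_lpBlock_bumpTerm_le φ hφ θ Φ N (2 ^ (n + 3)) (by positivity)
  refine ⟨2 * C, by positivity, fun j k X => ?_⟩
  obtain ⟨e, δ, he, hδ, hsplit⟩ := exists_lpPiece_smul Φ hρ j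
  set J := nearExp n j with hJ
  set A : ℝ := (2 : ℝ) ^ ((J : ℝ) * m) with hA
  have hA0 : 0 ≤ A := by positivity
  set B := box n (gridExp ρ J)
  set t := (spacing ρ J)⁻¹ * spacing ρ j with ht
  -- `t = 2^{(j-J)ρ}` with `j - J ≤ n + 3`: the rescaled bumps vary no faster than a fixed scale.
  have ht2 : |t| ≤ 2 ^ (n + 3) := by
    have h0 : t = (2 : ℝ) ^ (((j : ℝ) - J) * ρ) := by
      rw [ht, spacing, spacing, ← Real.rpow_neg (by norm_num), ← Real.rpow_add (by norm_num)]
      congr 1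
      ring
    rw [h0, abs_of_nonneg (by positivity), ← Real.rpow_natCast]
    refine Real.rpow_le_rpow_of_exponent_le (by norm_num) ?_
    have h1 : (j : ℝ) ≤ J + n + 3 := by exact_mod_cast le_nearExp n j
    push_cast
    nlinarith
  have hδ2 : ∀ b, |δ b| ≤ 2 ^ (n + 3) := fun b => (hδ b).trans (by
    calc (2 : ℝ) = 2 ^ 1 := (pow_one 2).symm
      _ ≤ 2 ^ (n + 3) := pow_le_pow_right₀ (by norm_num) (by omega))
  have hdecomp : rescaledSymbol Φ ρ (lacunarySymbol θ c ρ m) j = fun X =>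
      ∑ q ∈ (Finset.univ : Finset (Fin 2)) ×ˢ (B ×ˢ B),
        ((A : ℂ) * (e q.1 * c ((j + 3) / gap n) q.2)) *
          bumpTerm θ Φ t (δ q.1) (natVec q.2.1) (natVec q.2.2) X := by
    ext X
    rw [rescaledSymbol_lacunarySymbol hn hθ hΦ c hρ m j X]
    have h1 : (WithLp.toLp 2 (spacing ρ j • X.2.1, spacing ρ j • X.2.2) :
        WithLp 2 (Rn n × Rn n)) = spacing ρ j • WithLp.toLp 2 (X.2.1, X.2.2) := rfl
    rw [h1, hsplit, dyadicPiece, symPiece, Finset.sum_mul_sum, Finset.sum_comm, ← Finset.sum_product',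
      Finset.mul_sum]
    refine Finset.sum_congr rfl fun q _ => ?_
    simp only [bumpTerm, smul_smul, ht]
    ring
  rw [hdecomp, lpBlock_finset_sum]
  rotate_left
  · exact fun q _ => continuous_bumpTerm _ _ _ _ _ _
  · intro q _
    obtain ⟨b1, h1⟩ := exists_schwartz_bound θ
    obtain ⟨b2, h2⟩ := exists_schwartz_bound Φ
    have hb1 : 0 ≤ b1 := (norm_nonneg _).trans (h1 0)
    refine ⟨b1 * b1 * b2, fun X => ?_⟩
    rw [bumpTerm, norm_mul, norm_mul]
    exact mul_le_mul (mul_le_mul (h1 _) (h1 _) (norm_nonneg _) hb1) (h2 _) (norm_nonneg _)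
      (by positivity)
  have hterm : ∀ q ∈ (Finset.univ : Finset (Fin 2)) ×ˢ (B ×ˢ B),
      ‖((A : ℂ) * (e q.1 * c ((j + 3) / gap n) q.2)) *
        lpBlock φ k (bumpTerm θ Φ t (δ q.1) (natVec q.2.1) (natVec q.2.2)) X‖ ≤
      A * (C * ((2 : ℝ) ^ ((∑ i, k i) * N))⁻¹) := fun q _ => by
    rw [norm_mul, norm_mul, norm_mul, Complex.norm_real, Real.norm_of_nonneg hA0]
    have h1 : ‖e q.1‖ * ‖c ((j + 3) / gap n) q.2‖ ≤ 1 :=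
      mul_le_one₀ (he _) (norm_nonneg _) (hc _ _)
    gcongr
    · exact mul_le_of_le_one_right hA0 h1
    · exact hC _ _ _ _ _ _ ht2 (hδ2 _)
  -- The triangle inequality over all `2 · 2^{2nM}` terms, with `M = gridExp ρ J`, is the source of
  -- the loss.
  refine (norm_sum_le_of_le _ hterm).trans (le_of_eq ?_)
  rw [Finset.sum_const, Finset.card_product, Finset.card_product, card_box, nsmul_eq_mul,
    Finset.card_univ, Fintype.card_fin]
  push_cast
  rw [show 2 * n * gridExp ρ J = gridExp ρ J * n + gridExp ρ J * n by ring, pow_add]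
  ring

/-- Disjointness of the bumps bounds the piece by its amplitude, so there is no loss from their
number, but also no decay in `k`. -/
lemma exists_norm_lpBlock_rescaled_le {n : ℕ} (hn : 0 < n) (φ : 𝓢(Rn n, ℂ))
    {θ : 𝓢(Rn n, ℂ)} (hθ : IsBump θ)
    {Φ : 𝓢(WithLp 2 (Rn n × Rn n), ℂ)} (hΦ : IsLPGenerator Φ)
    {c : ℕ → (Fin n → ℕ) × (Fin n → ℕ) → ℂ} (hc : ∀ i p, ‖c i p‖ ≤ 1) {ρ : ℝ}
    (hρ : ρ < 1) (m : ℝ) :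
    ∃ C : ℝ, 0 ≤ C ∧ ∀ (j : ℕ) (k : Fin 3 → ℕ) (X : Rn3 n),
      ‖lpBlock φ k (rescaledSymbol Φ ρ (lacunarySymbol θ c ρ m) j) X‖ ≤
        C * (2 : ℝ) ^ ((nearExp n j : ℝ) * m) := by
  obtain ⟨C, hC0, hC⟩ := exists_norm_lpBlock_le φ
  obtain ⟨B, hB⟩ := exists_schwartz_bound Φ
  have hB0 : 0 ≤ B := (norm_nonneg _).trans (hB 0)
  refine ⟨C * (2 * B), by positivity, fun j k X => ?_⟩
  rw [mul_assoc]
  refine hC k _ _ (fun Y => ?_) X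
  rw [rescaledSymbol_lacunarySymbol hn hθ hΦ c hρ m j Y, norm_mul, norm_mul, Complex.norm_real,
    Real.norm_of_nonneg (by positivity), mul_comm (2 * B)]
  refine mul_le_mul_of_nonneg_left ?_ (by positivity)
  calc _ ≤ 1 * (2 * B) := mul_le_mul (norm_symPiece_le hθ (hc _) _ _ _ _)
        (norm_lpPiece_le hB _ _) (norm_nonneg _) zero_le_one
    _ = 2 * B := one_mul _

/-- Interpolating the uniform bound with the rapid decay, at the cost of an arbitrarily small
increase of the order. -/
lemma exists_norm_lpBlock_rescaled_weighted {n : ℕ} (hn : 0 < n) (φ : 𝓢(Rn n, ℂ))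
    (hφ : IsLPGenerator φ) {θ : 𝓢(Rn n, ℂ)} (hθ : IsBump θ)
    {Φ : 𝓢(WithLp 2 (Rn n × Rn n), ℂ)} (hΦ : IsLPGenerator Φ)
    {c : ℕ → (Fin n → ℕ) × (Fin n → ℕ) → ℂ} (hc : ∀ i p, ‖c i p‖ ≤ 1) {ρ : ℝ} (hρ0 : 0 ≤ ρ)
    (hρ : ρ < 1) {m m' : ℝ} (hm : m' < m) (s : Fin 3 → ℝ) :
    ∃ C : ℝ, 0 ≤ C ∧ ∀ (j : ℕ) (k : Fin 3 → ℕ) (X : Rn3 n),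
      ‖lpBlock φ k (rescaledSymbol Φ ρ (lacunarySymbol θ c ρ m') j) X‖ ≤
        C * (2 : ℝ) ^ ((j : ℝ) * m - ∑ i, (k i : ℝ) * (s i + 1)) := by
  have hn' : (0 : ℝ) < n := by exact_mod_cast hn
  -- The interpolation parameter: the loss `2^{2nJε}` must fit into the gap `2^{J(m-m')}`.
  set ε : ℝ := min 1 ((m - m') / (2 * n)) with hε
  have hε0 : 0 < ε := lt_min one_pos (div_pos (by linarith) (by positivity))
  have hε1 : ε ≤ 1 := min_le_left _ _
  have hε2 : 2 * n * ε ≤ m - m' := by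
    have := min_le_right 1 ((m - m') / (2 * n))
    rw [← hε, le_div_iff₀ (by positivity)] at this
    linarith
  -- After interpolation only `εN` of the decay survives; it has to beat each weight `s i` with one
  -- unit to spare for summability.
  obtain ⟨N, hN⟩ := exists_nat_ge ((∑ i, |s i| + 1) / ε)
  rw [div_le_iff₀ hε0] at hN
  have hNs : ∀ i, s i + 1 ≤ N * ε := fun i => by
    have h1 : |s i| ≤ ∑ i, |s i| :=
      Finset.single_le_sum (f := fun i => |s i|) (fun _ _ => abs_nonneg _) (Finset.mem_univ i)
    linarith [le_abs_self (s i)]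
  obtain ⟨C1, hC10, hC1⟩ := exists_norm_lpBlock_rescaled_le hn φ hθ hΦ hc hρ m'
  obtain ⟨C2, hC20, hC2⟩ := exists_norm_lpBlock_rescaled_decay hn φ hφ hθ hΦ hc hρ0 hρ m' N
  set C := max C1 C2
  have hC : 0 ≤ C := hC10.trans (le_max_left _ _)
  refine ⟨C * (2 : ℝ) ^ (|m| * (n + 3)), by positivity, fun j k X => ?_⟩
  set J := nearExp n j
  set x := ‖lpBlock φ k (rescaledSymbol Φ ρ (lacunarySymbol θ c ρ m') j) X‖
  set u : ℝ := 2 * n * gridExp ρ J - ∑ i, (k i : ℝ) * N with hu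
  have hq : ((2 : ℝ) ^ (2 * n * gridExp ρ J) * ((2 : ℝ) ^ ((∑ i, k i) * N))⁻¹) = (2 : ℝ) ^ u := by
    rw [hu, Real.rpow_sub (by norm_num), div_eq_mul_inv, ← Real.rpow_natCast, ← Real.rpow_natCast]
    push_cast
    rw [Finset.sum_mul]
  have hx1 : x ≤ C * (2 : ℝ) ^ ((J : ℝ) * m') * 1 := by
    rw [mul_one]
    refine (hC1 j k X).trans ?_
    gcongr
    exact le_max_left _ _
  have hx2 : x ≤ C * (2 : ℝ) ^ ((J : ℝ) * m') * (2 : ℝ) ^ u := by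
    rw [← hq]
    refine (hC2 j k X).trans ?_
    gcongr
    exact le_max_right _ _
  -- Interpolation in the form `min(1, 2^u) ≤ 2^{εu}` for `0 ≤ ε ≤ 1`.
  have hx : x ≤ C * (2 : ℝ) ^ ((J : ℝ) * m') * (2 : ℝ) ^ (ε * u) := by
    rcases le_total 0 u with h0 | h0
    · refine hx1.trans ?_
      gcongr
      exact Real.one_le_rpow (by norm_num) (by positivity)
    · refine hx2.trans ?_
      gcongr
      · norm_num
      · nlinarith
  refine hx.trans ?_
  rw [mul_assoc, mul_assoc, ← Real.rpow_add (by norm_num), ← Real.rpow_add (by norm_num)]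
  refine mul_le_mul_of_nonneg_left
    (Real.rpow_le_rpow_of_exponent_le (by norm_num) ?_) hC
  have hgrid : (gridExp ρ J : ℝ) ≤ J := by
    refine (Nat.floor_le (mul_nonneg (by positivity) (by linarith))).trans ?_
    exact mul_le_of_le_one_right (by positivity) (by linarith)
  have hsum : ∑ i, (k i : ℝ) * (s i + 1) ≤ ε * ∑ i, (k i : ℝ) * N := by
    rw [Finset.mul_sum]
    refine Finset.sum_le_sum fun i _ => ?_
    calc (k i : ℝ) * (s i + 1) ≤ (k i : ℝ) * (N * ε) := by gcongr; exact hNs i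
      _ = _ := by ring
  -- `|J - j| ≤ n + 3`, so replacing `J` by `j` costs a constant factor, for either sign of `m`.
  have hJ : (J : ℝ) * m ≤ j * m + |m| * (n + 3) := by
    have h1 : (J : ℝ) ≤ j + 3 := by exact_mod_cast nearExp_le n j
    have h2 : (j : ℝ) ≤ J + n + 3 := by exact_mod_cast le_nearExp n j
    have h3 : |((J : ℝ) - j) * m| ≤ (n + 3) * |m| := by
      rw [abs_mul]
      gcongr
      rw [abs_le]
      constructor <;> linarith
    nlinarith [le_abs_self (((J : ℝ) - j) * m)]
  have hJ0 : (0 : ℝ) ≤ J := by positivity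
  have h4 : ε * (2 * n * gridExp ρ J) ≤ J * (m - m') := by
    calc ε * (2 * n * gridExp ρ J) = (2 * n * ε) * gridExp ρ J := by ring
      _ ≤ (m - m') * J := mul_le_mul hε2 hgrid (by positivity) (by linarith)
      _ = _ := mul_comm _ _
  rw [hu, mul_sub]
  linarith

/-! ### Uniformly local norms and summation over the blocks -/

lemma volume_unitCube_lt_top (n : ℕ) : volume (unitCube n) < ∞ := by
  refine (Metric.isBounded_closedBall (x := (0 : Rn n)) (r := n)).subset ?_ |>.measure_lt_top
  intro x hx
  rw [mem_closedBall_zero_iff]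
  have h2 : x = ∑ i, EuclideanSpace.single i (x i) := by
    ext j
    simp
  rw [h2]
  calc _ ≤ ∑ _i : Fin n, (1 : ℝ) := norm_sum_le_of_le _ fun i _ => by
        rw [EuclideanSpace.single, PiLp.norm_single, Real.norm_eq_abs, abs_le]
        have := hx i
        rw [Set.mem_Ico] at this
        constructor <;> linarith
    _ = _ := by simp

lemma exists_ulNorm_le (n : ℕ) : ∃ V : ℝ≥0, ∀ (F : Rn3 n → ℂ) (K : ℝ), (∀ X, ‖F X‖ ≤ K) →
    ulNorm F ≤ V * ENNReal.ofReal K := by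
  set μ : Measure (Rn3 n) := volume.restrict (unitCube n ×ˢ unitCube n ×ˢ unitCube n)
  have hμ : μ Set.univ ≠ ∞ := by
    have h := volume_unitCube_lt_top n
    rw [Measure.restrict_apply_univ, Measure.volume_eq_prod, Measure.prod_prod,
      Measure.volume_eq_prod, Measure.prod_prod]
    exact (ENNReal.mul_lt_top h (ENNReal.mul_lt_top h h)).ne
  have hV : μ Set.univ ^ (2 : ℝ≥0∞).toReal⁻¹ ≠ ∞ := ENNReal.rpow_ne_top_of_nonneg (by simp) hμ
  refine ⟨(μ Set.univ ^ (2 : ℝ≥0∞).toReal⁻¹).toNNReal, fun F K hK => ?_⟩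
  rw [ENNReal.coe_toNNReal hV]
  exact iSup_le fun ν => eLpNorm_le_of_ae_bound (.of_forall fun X => hK _)

lemma tsum_two_rpow_lt_top :
    ∑' k : Fin 3 → ℕ, ENNReal.ofReal ((2 : ℝ) ^ (-∑ i, (k i : ℝ))) < ∞ := by
  let e : ℕ × ℕ × ℕ ≃ (Fin 3 → ℕ) :=
    { toFun := fun p => ![p.1, p.2.1, p.2.2]
      invFun := fun k => (k 0, k 1, k 2)
      left_inv := fun p => rfl
      right_inv := fun k => by ext i; fin_cases i <;> rfl }
  have h1 : ∀ a : ℕ, ENNReal.ofReal ((2 : ℝ) ^ (-(a : ℝ))) = (2⁻¹ : ℝ≥0∞) ^ a := fun a => by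
    rw [Real.rpow_neg (by norm_num), Real.rpow_natCast, ← inv_pow,
      ENNReal.ofReal_pow (by norm_num), ENNReal.ofReal_inv_of_pos (by norm_num)]
    norm_num
  have h2 : ∀ p : ℕ × ℕ × ℕ, ENNReal.ofReal ((2 : ℝ) ^ (-∑ i, (e p i : ℝ))) =
      (2⁻¹ : ℝ≥0∞) ^ p.1 * ((2⁻¹ : ℝ≥0∞) ^ p.2.1 * (2⁻¹ : ℝ≥0∞) ^ p.2.2) := fun p => by
    rw [← h1, ← h1, ← h1, ← ENNReal.ofReal_mul (by positivity),
      ← ENNReal.ofReal_mul (by positivity), ← Real.rpow_add (by norm_num),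
      ← Real.rpow_add (by norm_num)]
    congr 2
    rw [Fin.sum_univ_three]
    change -((p.1 : ℝ) + p.2.1 + p.2.2) = _
    ring
  rw [← e.tsum_eq]
  simp only [h2]
  rw [ENNReal.tsum_prod (f := fun a (b : ℕ × ℕ) =>
    (2⁻¹ : ℝ≥0∞) ^ a * ((2⁻¹ : ℝ≥0∞) ^ b.1 * (2⁻¹ : ℝ≥0∞) ^ b.2))]
  simp only [ENNReal.tsum_mul_left, ENNReal.tsum_mul_right]
  rw [ENNReal.tsum_prod (f := fun a b : ℕ => (2⁻¹ : ℝ≥0∞) ^ a * (2⁻¹ : ℝ≥0∞) ^ b)]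
  simp only [ENNReal.tsum_mul_left, ENNReal.tsum_mul_right]
  rw [ENNReal.tsum_geometric, ENNReal.one_sub_inv_two, inv_inv]
  exact ENNReal.mul_lt_top (by norm_num) (ENNReal.mul_lt_top (by norm_num) (by norm_num))

theorem lacunarySymbol_mem_symbolClass {n : ℕ} (hn : 0 < n) (φ : 𝓢(Rn n, ℂ))
    (hφ : IsLPGenerator φ) {θ : 𝓢(Rn n, ℂ)} (hθ : IsBump θ)
    {Φ : 𝓢(WithLp 2 (Rn n × Rn n), ℂ)} (hΦ : IsLPGenerator Φ)
    {c : ℕ → (Fin n → ℕ) × (Fin n → ℕ) → ℂ} (hc : ∀ i p, ‖c i p‖ ≤ 1) {ρ : ℝ} (hρ0 : 0 ≤ ρ)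
    (hρ : ρ < 1) {m m' : ℝ} (hm : m' < m) (hm' : m' ≤ 0) (s : Fin 3 → ℝ) :
    lacunarySymbol θ c ρ m' ∈ symbolClass φ Φ m ρ s := by
  refine ⟨memLp_lacunarySymbol hn hθ hc hρ hm', ?_⟩
  obtain ⟨C, hC0, hC⟩ := exists_norm_lpBlock_rescaled_weighted hn φ hφ hθ hΦ hc hρ0 hρ hm s
  obtain ⟨V, hV⟩ := exists_ulNorm_le n
  have hfin : V * ENNReal.ofReal C *
      ∑' k : Fin 3 → ℕ, ENNReal.ofReal ((2 : ℝ) ^ (-∑ i, (k i : ℝ))) < ∞ :=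
    ENNReal.mul_lt_top (ENNReal.mul_lt_top ENNReal.coe_lt_top ENNReal.ofReal_lt_top)
      tsum_two_rpow_lt_top
  refine lt_of_le_of_lt (iSup_le fun j => ?_) hfin
  rw [← ENNReal.tsum_mul_left]
  refine ENNReal.tsum_le_tsum fun k => ?_
  refine (mul_le_mul_right (hV _ _ (hC j k)) _).trans (le_of_eq ?_)
  rw [ENNReal.ofReal_mul hC0]
  -- The weights of the norm cancel everything except the spare geometric decay, uniformly in `j`.
  have h1 : (2 : ℝ) ^ (-∑ i, (k i : ℝ)) = (2 : ℝ) ^ (-((j : ℝ) * m) + ∑ i, (k i : ℝ) * s i) *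
      (2 : ℝ) ^ ((j : ℝ) * m - ∑ i, (k i : ℝ) * (s i + 1)) := by
    rw [← Real.rpow_add (by norm_num)]
    congr 1
    simp only [mul_add, mul_one, Finset.sum_add_distrib]
    ring
  rw [h1, ENNReal.ofReal_mul (by positivity)]
  ring

/-! ### The bilinear operator on modulated bumps -/

lemma fourierHat_eq_fourier {n : ℕ} (f : Rn n → ℂ) (ξ : Rn n) :
    fourierHat f ξ = 𝓕 f ((2 * Real.pi)⁻¹ • ξ) := by
  rw [fourierHat_eq, fourier_eq_expI]
  simp only [inner_smul_right, mul_inv_cancel_left₀ two_pi_ne]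

lemma two_pi_inv_ne : ((2 * Real.pi)⁻¹ : ℝ) ≠ 0 := inv_ne_zero two_pi_ne

/-- Inversion for a translated Fourier profile. -/
lemma fourierCheck_translate {n : ℕ} (b : 𝓢(Rn n, ℂ)) (a x : Rn n) :
    fourierCheck (fun ξ => dilate (2 * Real.pi)⁻¹ two_pi_inv_ne b (ξ - a)) x =
      expI (inner ℝ x a) * (𝓕⁻ b : 𝓢(Rn n, ℂ)) x := by
  rw [fourierInv_coe, fourierInv_eq_expI, fourierCheck_eq,
    ← integral_add_right_eq_self _ a]
  have := Measure.integral_comp_smul (volume : Measure (Rn n))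
    (fun ζ : Rn n => expI (2 * Real.pi * inner ℝ ζ x) * b ζ) (2 * Real.pi)⁻¹
  simp only [inner_smul_left, conj_trivial, mul_inv_cancel_left₀ two_pi_ne, finrank_euclideanSpace,
    Fintype.card_fin, inv_pow, inv_inv] at this
  simp only [add_sub_cancel_right, dilate_apply, inner_add_right, expI_add]
  have h1 : ∀ ξ : Rn n, expI (inner ℝ x ξ) * expI (inner ℝ x a) * b ((2 * Real.pi)⁻¹ • ξ) =
      expI (inner ℝ x a) * (expI (inner ℝ ξ x) * b ((2 * Real.pi)⁻¹ • ξ)) := fun ξ => by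
    rw [real_inner_comm ξ x]
    ring
  simp only [h1]
  rw [integral_const_mul, this, abs_of_pos (by positivity), Complex.real_smul]
  have h2 : (((2 * Real.pi) ^ n : ℝ) : ℂ) ≠ 0 := by
    exact_mod_cast (pow_pos Real.two_pi_pos n).ne'
  field_simp

/-- A trigonometric polynomial times a fixed Schwartz function, with its Fourier transform. -/
lemma exists_modulated {n : ℕ} (b : 𝓢(Rn n, ℂ)) (s : Finset (Fin n → ℕ)) (A : (Fin n → ℕ) → ℝ)
    (l : ℝ) : ∃ f : 𝓢(Rn n, ℂ),
      (∀ x, f x = (∑ κ ∈ s, (A κ : ℂ) * expI (inner ℝ (l • x) (natVec κ))) *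
        (𝓕⁻ b : 𝓢(Rn n, ℂ)) x) ∧
      ∀ ξ, fourierHat f ξ =
        ∑ κ ∈ s, (A κ : ℂ) * dilate (2 * Real.pi)⁻¹ two_pi_inv_ne b (ξ - l • natVec κ) := by
  let F : 𝓢(Rn n, ℂ) := ∑ κ ∈ s, (A κ : ℂ) •
    compSubConstCLM ℂ ((2 * Real.pi)⁻¹ • l • natVec κ) b
  have hF : ∀ ζ, F ζ = ∑ κ ∈ s, (A κ : ℂ) * b (ζ - (2 * Real.pi)⁻¹ • l • natVec κ) := fun ζ => by
    simp [F, sum_apply]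
  refine ⟨𝓕⁻ F, fun x => ?_, fun ξ => ?_⟩
  · rw [fourierInv_coe, fourierInv_eq_expI]
    simp only [hF, Finset.mul_sum, Finset.sum_mul]
    have hint : ∀ a : Rn n, Integrable fun v : Rn n => expI (2 * Real.pi * inner ℝ v x) * b (v - a) :=
      fun a => ((b.integrable (μ := volume)).comp_sub_right a).bdd_mul (c := 1) (by fun_prop)
        (.of_forall fun _ => (norm_expI _).le)
    rw [integral_finsetSum]
    · refine Finset.sum_congr rfl fun κ _ => ?_
      rw [fourierInv_coe, fourierInv_eq_expI, mul_assoc, ← integral_const_mul,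
        ← integral_const_mul, ← integral_add_right_eq_self _ ((2 * Real.pi)⁻¹ • l • natVec κ)]
      refine integral_congr_ae (.of_forall fun v => ?_)
      simp only [inner_add_right, inner_smul_right, real_inner_smul_left, mul_add, expI_add,
        mul_inv_cancel_left₀ two_pi_ne, add_sub_cancel_right, real_inner_comm x]
      ring
    · intro κ _
      refine ((hint ((2 * Real.pi)⁻¹ • l • natVec κ)).const_mul (A κ : ℂ)).congr
        (.of_forall fun v => ?_)
      simp only
      ring
  · have h : 𝓕 (𝓕⁻ F : 𝓢(Rn n, ℂ)) = F := fourier_fourierInv_eq (F := 𝓢(Rn n, ℂ)) F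
    rw [fourierHat_eq_fourier, ← fourier_coe, h, hF]
    simp only [dilate_apply, smul_sub]

/-- A nonnegative bump on the Fourier side with support well inside the unit lattice spacing. -/
structure IsProfile {n : ℕ} (b : 𝓢(Rn n, ℂ)) : Prop where
  eq_zero : ∀ ζ, 1 / 64 ≤ ‖ζ‖ → b ζ = 0
  integral_ne_zero : ∫ ζ, b ζ ≠ 0

lemma exists_isProfile (n : ℕ) : ∃ b : 𝓢(Rn n, ℂ), IsProfile b := by
  obtain ⟨b, h1, h2, h3⟩ := exists_schwartz_bump (Rn n) (r := 1 / 128) (R := 1 / 64)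
    (by norm_num) (by norm_num)
  refine ⟨b, h2, fun h0 => ?_⟩
  choose c hc0 hc1 hc using h3
  have hcr : c = fun x => (b x).re := funext fun x => by rw [hc x, Complex.ofReal_re]
  have hci : Integrable c := hcr ▸ b.integrable.re
  have h4 : ∫ x, c x = 0 := by
    have : ∫ x, b x = ((∫ x, c x : ℝ) : ℂ) := by
      rw [← integral_complex_ofReal]
      exact integral_congr_ae (.of_forall hc)
    rw [this] at h0
    exact_mod_cast h0
  have h5 : 0 < ∫ x, c x := by
    rw [integral_pos_iff_support_of_nonneg hc0 hci]
    refine lt_of_lt_of_le (Metric.measure_ball_pos volume (0 : Rn n) (r := 1 / 128) (by norm_num))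
      (measure_mono fun x hx => ?_)
    rw [mem_ball_zero_iff] at hx
    have h6 := h1 x hx.le
    rw [hc x] at h6
    rw [Function.mem_support]
    intro h7
    rw [h7] at h6
    norm_num at h6
  exact h5.ne' h4

lemma norm_le_of_dilate_ne_zero {n : ℕ} {b : 𝓢(Rn n, ℂ)} (hb : IsProfile b) {ξ : Rn n}
    (h : dilate (2 * Real.pi)⁻¹ two_pi_inv_ne b ξ ≠ 0) : ‖ξ‖ ≤ 1 / 8 := by
  by_contra h1
  push Not at h1
  refine h (hb.eq_zero _ ?_)
  change 1 / 64 ≤ ‖(2 * Real.pi)⁻¹ • ξ‖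
  rw [norm_smul, Real.norm_of_nonneg (by positivity), inv_mul_eq_div, le_div_iff₀ (by positivity)]
  linarith [Real.pi_lt_four]

/-- The symbol piece acts on modulated profiles by multiplying with its coefficients. -/
lemma symPiece_mul_profile {n : ℕ} {θ : 𝓢(Rn n, ℂ)} (hθ : IsBump θ) {b : 𝓢(Rn n, ℂ)}
    (hb : IsProfile b) (c : (Fin n → ℕ) × (Fin n → ℕ) → ℂ) {M : ℕ} {l : ℝ} (hl : 1 ≤ l)
    {p : (Fin n → ℕ) × (Fin n → ℕ)} (hp : p ∈ box n M ×ˢ box n M) {ξ η : Rn n}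
    (h : dilate (2 * Real.pi)⁻¹ two_pi_inv_ne b (ξ - l • natVec p.1) *
      dilate (2 * Real.pi)⁻¹ two_pi_inv_ne b (η - l • natVec p.2) ≠ 0) :
    symPiece θ c M l ξ η = c p := by
  have hl0 : l ≠ 0 := by linarith
  have key : ∀ {v κ : Rn n}, ‖v - l • κ‖ ≤ 1 / 8 → ‖l⁻¹ • v - κ‖ ≤ 1 / 8 := fun {v κ} hv => by
    have h1 : l⁻¹ • v - κ = l⁻¹ • (v - l • κ) := by rw [smul_sub, inv_smul_smul₀ hl0]
    rw [h1, norm_smul, Real.norm_of_nonneg (by positivity)]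
    exact (mul_le_of_le_one_left (norm_nonneg _) (inv_le_one_of_one_le₀ hl)).trans hv
  have h1 := key (norm_le_of_dilate_ne_zero hb (left_ne_zero_of_mul h))
  have h2 := key (norm_le_of_dilate_ne_zero hb (right_ne_zero_of_mul h))
  rw [symPiece, Finset.sum_eq_single_of_mem p hp, hθ.eq_one _ h1, hθ.eq_one _ h2, mul_one, mul_one]
  intro q _ hq
  by_cases h3 : q.1 = p.1
  · have h4 : q.2 ≠ p.2 := fun h4 => hq (Prod.ext h3 h4)
    rw [hθ.eq_zero_of_ne (h2.trans (by norm_num)) h4, mul_zero, mul_zero]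
  · rw [hθ.eq_zero_of_ne (h1.trans (by norm_num)) h3, zero_mul, mul_zero]

/-- On the support of each pair of profiles the symbol is a constant. Its factors `A M` cancel those
of `f̂` because they are signs, leaving only `D (p.1 + p.2)`. -/
lemma bilinearOp_lacunarySymbol {n : ℕ} (hn : 0 < n) {θ : 𝓢(Rn n, ℂ)} (hθ : IsBump θ)
    {b : 𝓢(Rn n, ℂ)} (hb : IsProfile b) (A : ℕ → (Fin n → ℕ) → ℝ) (hA : ∀ M κ, |A M κ| = 1)
    {ρ : ℝ} (hρ0 : 0 ≤ ρ) (hρ : ρ < 1) (m : ℝ) (i : ℕ) {M : ℕ} (hM : M = gridExp ρ (gap n * i))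
    {l : ℝ} (hl : l = spacing ρ (gap n * i)) (D : (Fin n → ℕ) → ℝ) (hD : ∀ κ, |D κ| = 1)
    (c : ℕ → (Fin n → ℕ) × (Fin n → ℕ) → ℂ)
    (hc : ∀ p, c i p = A M p.1 * A M p.2 * D (p.1 + p.2)) {f : 𝓢(Rn n, ℂ)}
    (hf : ∀ ξ, fourierHat f ξ = ∑ κ ∈ box n M, (A M κ : ℂ) *
      dilate (2 * Real.pi)⁻¹ two_pi_inv_ne b (ξ - l • natVec κ)) (x : Rn n) :
    bilinearOp (lacunarySymbol θ c ρ m) f f x =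
      (((2 : ℝ) ^ (((gap n * i : ℕ) : ℝ) * m) : ℝ) : ℂ) *
        ∑ p ∈ box n M ×ˢ box n M, (D (p.1 + p.2) : ℂ) *
          (expI (inner ℝ (l • x) (natVec (p.1 + p.2))) *
            ((𝓕⁻ b : 𝓢(Rn n, ℂ)) x * (𝓕⁻ b : 𝓢(Rn n, ℂ)) x)) := by
  set χ := dilate (2 * Real.pi)⁻¹ two_pi_inv_ne b with hχ
  set w : ℂ := (((2 : ℝ) ^ (((gap n * i : ℕ) : ℝ) * m) : ℝ) : ℂ) with hw
  have hl1 : 1 ≤ l := hl ▸ one_le_spacing hρ0 _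
  have hsq : ∀ κ, (A M κ : ℂ) * A M κ = 1 := fun κ => by
    rw [← Complex.ofReal_mul, ← abs_mul_abs_self, hA, one_mul, Complex.ofReal_one]
  have hpt : ∀ z : Rn n × Rn n,
      Complex.exp (Complex.I * ((inner ℝ x (z.1 + z.2) : ℝ) : ℂ)) *
        lacunarySymbol θ c ρ m (x, z.1, z.2) * fourierHat f z.1 * fourierHat f z.2 =
      ∑ p ∈ box n M ×ˢ box n M, w * D (p.1 + p.2) *
        ((expI (inner ℝ x z.1) * χ (z.1 - l • natVec p.1)) *
          (expI (inner ℝ x z.2) * χ (z.2 - l • natVec p.2))) := fun z => by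
    rw [mul_assoc _ (fourierHat f z.1), hf, hf, Finset.sum_mul_sum, ← Finset.sum_product',
      Finset.mul_sum]
    refine Finset.sum_congr rfl fun p hp => ?_
    by_cases h0 : χ (z.1 - l • natVec p.1) * χ (z.2 - l • natVec p.2) = 0
    · linear_combination (Complex.exp (Complex.I * ((inner ℝ x (z.1 + z.2) : ℝ) : ℂ)) *
        lacunarySymbol θ c ρ m (x, z.1, z.2) * A M p.1 * A M p.2 - w * D (p.1 + p.2) *
          expI (inner ℝ x z.1) * expI (inner ℝ x z.2)) * h0
    -- Here the `i`-th piece is nonzero, so by disjointness it is the only one present in the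
    -- lacunary sum.
    · have h1 : dyadicPiece θ (c i) ρ (gap n * i) z.1 z.2 = c i p := by
        rw [dyadicPiece, ← hM, ← hl]
        exact symPiece_mul_profile hθ hb (c i) hl1 hp h0
      have h2 : c i p ≠ 0 := by
        rw [hc]
        have : ∀ t : ℝ, |t| = 1 → (t : ℂ) ≠ 0 := fun t ht h => by
          rw [Complex.ofReal_eq_zero] at h
          rw [h, abs_zero] at ht
          exact zero_ne_one ht
        exact mul_ne_zero (mul_ne_zero (this _ (hA _ _)) (this _ (hA _ _))) (this _ (hD _))
      rw [lacunarySymbol_eq_of_ne_zero hn hθ c hρ m (X := (x, z.1, z.2)) (i := i)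
        (by rw [h1]; exact h2)]
      simp only [h1]
      rw [hc, ← hw]
      change expI (inner ℝ x (z.1 + z.2)) * _ * _ = _
      rw [inner_add_right, expI_add]
      linear_combination (expI (inner ℝ x z.1) * expI (inner ℝ x z.2) * w * D (p.1 + p.2) *
        χ (z.1 - l • natVec p.1) * χ (z.2 - l • natVec p.2)) *
          ((A M p.2 : ℂ) * A M p.2 * hsq p.1 + hsq p.2)
  have hint : ∀ κ : Fin n → ℕ,
      Integrable fun v : Rn n => expI (inner ℝ x v) * χ (v - l • natVec κ) :=
    fun κ => ((χ.integrable (μ := volume)).comp_sub_right _).bdd_mul (c := 1) (by fun_prop)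
      (.of_forall fun _ => (norm_expI _).le)
  rw [bilinearOp, integral_congr_ae (.of_forall hpt), integral_finsetSum _
    fun p _ => ((hint p.1).mul_prod (hint p.2)).const_mul _, Finset.mul_sum, Finset.mul_sum]
  refine Finset.sum_congr rfl fun p _ => ?_
  rw [integral_const_mul, Measure.volume_eq_prod,
    integral_prod_mul (fun v => expI (inner ℝ x v) * χ (v - l • natVec p.1))
      fun v => expI (inner ℝ x v) * χ (v - l • natVec p.2)]
  have h3 : ∀ κ : Fin n → ℕ, (((2 * Real.pi) ^ n : ℝ) : ℂ)⁻¹ *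
      ∫ v : Rn n, expI (inner ℝ x v) * χ (v - l • natVec κ) =
      expI (inner ℝ (l • x) (natVec κ)) * (𝓕⁻ b : 𝓢(Rn n, ℂ)) x := fun κ => by
    rw [inner_smul_left, conj_trivial, ← inner_smul_right, ← fourierCheck_translate]
    rfl
  rw [natVec_add, inner_add_right, expI_add]
  have h4 : (((2 * Real.pi) ^ (2 * n) : ℝ) : ℂ)⁻¹ =
      (((2 * Real.pi) ^ n : ℝ) : ℂ)⁻¹ * (((2 * Real.pi) ^ n : ℝ) : ℂ)⁻¹ := by
    rw [two_mul n, pow_add, Complex.ofReal_mul, mul_inv]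
  rw [h4]
  calc _ = w * D (p.1 + p.2) * (((((2 * Real.pi) ^ n : ℝ) : ℂ)⁻¹ *
      ∫ v : Rn n, expI (inner ℝ x v) * χ (v - l • natVec p.1)) *
        ((((2 * Real.pi) ^ n : ℝ) : ℂ)⁻¹ *
      ∫ v : Rn n, expI (inner ℝ x v) * χ (v - l • natVec p.2))) := by ring
    _ = _ := by rw [h3, h3]; ring

/-! ### Testing against a modulated function -/

/-- A Fourier-side bump used for testing products of two profiles. -/
structure IsTestProfile {n : ℕ} (b : 𝓢(Rn n, ℂ)) : Prop where
  eq_one : ∀ ζ, ‖ζ‖ ≤ 1 / 32 → b ζ = 1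
  eq_zero : ∀ ζ, 3 / 32 ≤ ‖ζ‖ → b ζ = 0

lemma exists_isTestProfile (n : ℕ) : ∃ b : 𝓢(Rn n, ℂ), IsTestProfile b := by
  obtain ⟨b, h1, h2, -⟩ := exists_schwartz_bump (Rn n) (r := 1 / 32) (R := 3 / 32)
    (by norm_num) (by norm_num)
  exact ⟨b, h1, h2⟩

/-- Parseval for three factors; vanishing or nonvanishing becomes a question about supports of `b`
and `d`. -/
lemma integral_expI_mul_profiles {n : ℕ} (b d : 𝓢(Rn n, ℂ)) (y : Rn n) :
    ∫ x, expI (inner ℝ x y) * ((𝓕⁻ b : 𝓢(Rn n, ℂ)) x * (𝓕⁻ b : 𝓢(Rn n, ℂ)) x *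
      (𝓕⁻ d : 𝓢(Rn n, ℂ)) x) =
    ∫ z : Rn n × Rn n, b z.1 * b z.2 * d (-((2 * Real.pi)⁻¹ • y + z.1 + z.2)) := by
  set v : 𝓢(Rn n, ℂ) := 𝓕⁻ d with hv
  have hd : 𝓕 v = d := fourier_fourierInv_eq (F := 𝓢(Rn n, ℂ)) d
  have h1 : ∀ x, expI (inner ℝ x y) * ((𝓕⁻ b : 𝓢(Rn n, ℂ)) x * (𝓕⁻ b : 𝓢(Rn n, ℂ)) x * v x) =
      ∫ z : Rn n × Rn n, expI (inner ℝ x (y + (2 * Real.pi) • (z.1 + z.2))) *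
        (v x * (b z.1 * b z.2)) := fun x => by
    rw [fourierInv_coe, fourierInv_eq_expI, ← integral_prod_mul, mul_comm _ (v x), ← mul_assoc,
      ← integral_const_mul]
    refine integral_congr_ae (.of_forall fun z => ?_)
    simp only [inner_add_right, inner_smul_right, mul_add, expI_add, real_inner_comm x]
    ring
  simp only [h1]
  rw [integral_integral_swap]
  · refine integral_congr_ae (.of_forall fun z => ?_)
    simp only
    rw [← hd, fourier_coe, fourier_eq_expI, ← integral_const_mul]
    refine integral_congr_ae (.of_forall fun x => ?_)
    have h2 : -(2 * Real.pi * inner ℝ x (-((2 * Real.pi)⁻¹ • y + z.1 + z.2))) =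
        inner ℝ x (y + (2 * Real.pi) • (z.1 + z.2)) := by
      simp only [inner_neg_right, inner_add_right, inner_smul_right, mul_add, mul_neg, neg_neg,
        mul_inv_cancel_left₀ two_pi_ne, add_assoc]
    simp only [h2]
    ring
  · refine (v.integrable.mul_prod (b.integrable.mul_prod b.integrable)).bdd_mul (c := 1) ?_
      (.of_forall fun _ => (norm_expI _).le)
    fun_prop

/-- Orthogonality of different frequencies: `‖(2π)⁻¹ y‖ ≥ 1/8` as `π < 4`, and `1/8 - 2/64 = 3/32`
is where `d` vanishes. -/
lemma integral_expI_mul_profiles_eq_zero {n : ℕ} {b d : 𝓢(Rn n, ℂ)} (hb : IsProfile b)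
    (hd : IsTestProfile d) {y : Rn n} (hy : 1 ≤ ‖y‖) :
    ∫ x, expI (inner ℝ x y) * ((𝓕⁻ b : 𝓢(Rn n, ℂ)) x * (𝓕⁻ b : 𝓢(Rn n, ℂ)) x *
      (𝓕⁻ d : 𝓢(Rn n, ℂ)) x) = 0 := by
  rw [integral_expI_mul_profiles]
  refine integral_eq_zero_of_ae (.of_forall fun z => ?_)
  by_contra h
  have h1 : ‖z.1‖ < 1 / 64 := by
    by_contra h2
    exact h (by simp [hb.eq_zero z.1 (not_lt.1 h2)])
  have h2 : ‖z.2‖ < 1 / 64 := by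
    by_contra h2
    exact h (by simp [hb.eq_zero z.2 (not_lt.1 h2)])
  refine h (mul_eq_zero_of_right _ (hd.eq_zero _ ?_))
  rw [norm_neg]
  have h3 : 1 / 8 ≤ ‖(2 * Real.pi)⁻¹ • y‖ := by
    rw [norm_smul, Real.norm_of_nonneg (by positivity), inv_mul_eq_div,
      le_div_iff₀ (by positivity)]
    linarith [Real.pi_lt_four]
  have h4 : ‖(2 * Real.pi)⁻¹ • y‖ ≤ ‖(2 * Real.pi)⁻¹ • y + z.1 + z.2‖ + ‖z.1 + z.2‖ := by
    have := norm_sub_le ((2 * Real.pi)⁻¹ • y + z.1 + z.2) (z.1 + z.2)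
    rwa [show (2 * Real.pi)⁻¹ • y + z.1 + z.2 - (z.1 + z.2) = (2 * Real.pi)⁻¹ • y by abel]
      at this
  have := norm_add_le z.1 z.2
  linarith

lemma integral_profiles {n : ℕ} {b d : 𝓢(Rn n, ℂ)} (hb : IsProfile b) (hd : IsTestProfile d) :
    ∫ x, (𝓕⁻ b : 𝓢(Rn n, ℂ)) x * (𝓕⁻ b : 𝓢(Rn n, ℂ)) x * (𝓕⁻ d : 𝓢(Rn n, ℂ)) x =
      (∫ ζ, b ζ) * ∫ ζ, b ζ := by
  have h := integral_expI_mul_profiles b d 0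
  simp only [inner_zero_right, expI_zero, one_mul, smul_zero, zero_add] at h
  rw [h, ← integral_prod_mul]
  refine integral_congr_ae (.of_forall fun z => ?_)
  simp only
  by_cases h1 : ‖z.1‖ < 1 / 64
  · by_cases h2 : ‖z.2‖ < 1 / 64
    · rw [hd.eq_one, mul_one]
      rw [norm_neg]
      linarith [norm_add_le z.1 z.2]
    · simp [hb.eq_zero z.2 (not_lt.1 h2)]
  · simp [hb.eq_zero z.1 (not_lt.1 h1)]

/-- For each pair `p` only `μ = p.1 + p.2` survives, and there the two signs `D` multiply to `1`;
all `2^{2nM}` pairs contribute equally. -/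
lemma integral_trig_mul_test {n M : ℕ} {b d : 𝓢(Rn n, ℂ)} (hb : IsProfile b)
    (hd : IsTestProfile d) (D : (Fin n → ℕ) → ℝ) (hD : ∀ κ, |D κ| = 1) {l : ℝ} (hl : 1 ≤ l)
    (w : ℂ) :
    ∫ x : Rn n, (w * ∑ p ∈ box n M ×ˢ box n M, (D (p.1 + p.2) : ℂ) *
          (expI (inner ℝ (l • x) (natVec (p.1 + p.2))) *
            ((𝓕⁻ b : 𝓢(Rn n, ℂ)) x * (𝓕⁻ b : 𝓢(Rn n, ℂ)) x))) *
        ((∑ μ ∈ box n (M + 1), (D μ : ℂ) * expI (inner ℝ (-(l • x)) (natVec μ))) *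
          (𝓕⁻ d : 𝓢(Rn n, ℂ)) x) =
      w * 2 ^ (2 * n * M) * ((∫ ζ, b ζ) * ∫ ζ, b ζ) := by
  set u : 𝓢(Rn n, ℂ) := 𝓕⁻ b
  set v : 𝓢(Rn n, ℂ) := 𝓕⁻ d
  have hexp : ∀ x : Rn n, (w * ∑ p ∈ box n M ×ˢ box n M, (D (p.1 + p.2) : ℂ) *
          (expI (inner ℝ (l • x) (natVec (p.1 + p.2))) * (u x * u x))) *
        ((∑ μ ∈ box n (M + 1), (D μ : ℂ) * expI (inner ℝ (-(l • x)) (natVec μ))) * v x) =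
      ∑ p ∈ box n M ×ˢ box n M, ∑ μ ∈ box n (M + 1), (w * D (p.1 + p.2) * D μ) *
        (expI (inner ℝ x (l • (natVec (p.1 + p.2) - natVec μ))) * (u x * u x * v x)) := fun x => by
    rw [mul_assoc, ← mul_assoc (∑ p ∈ _, _), Finset.sum_mul_sum, Finset.sum_mul, Finset.mul_sum]
    refine Finset.sum_congr rfl fun p _ => ?_
    rw [Finset.sum_mul, Finset.mul_sum]
    refine Finset.sum_congr rfl fun μ _ => ?_
    simp only [inner_neg_left, inner_smul_left, inner_smul_right, conj_trivial, inner_sub_right,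
      mul_sub]
    rw [sub_eq_add_neg, expI_add]
    ring
  obtain ⟨Bu, hBu⟩ := exists_schwartz_bound u
  have hBu0 : 0 ≤ Bu := (norm_nonneg _).trans (hBu 0)
  have hint : ∀ y : Rn n, Integrable fun x => expI (inner ℝ x y) * (u x * u x * v x) := fun y => by
    have h1 : Integrable fun x => u x * u x * v x :=
      v.integrable.bdd_mul (c := Bu * Bu) (by fun_prop) (.of_forall fun x => by
        rw [norm_mul]
        exact mul_le_mul (hBu x) (hBu x) (norm_nonneg _) hBu0)
    exact h1.bdd_mul (c := 1) (by fun_prop) (.of_forall fun _ => (norm_expI _).le)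
  simp only [hexp]
  rw [integral_finsetSum _ fun p _ => integrable_finsetSum _ fun μ _ => (hint _).const_mul _]
  have hp : ∀ p ∈ box n M ×ˢ box n M, ∫ x, ∑ μ ∈ box n (M + 1), (w * D (p.1 + p.2) * D μ) *
        (expI (inner ℝ x (l • (natVec (p.1 + p.2) - natVec μ))) * (u x * u x * v x)) =
      w * ((∫ ζ, b ζ) * ∫ ζ, b ζ) := fun p hp => by
    rw [Finset.mem_product] at hp
    rw [integral_finsetSum _ fun μ _ => (hint _).const_mul _,
      Finset.sum_eq_single_of_mem _ (add_mem_box hp.1 hp.2), integral_const_mul]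
    · simp only [sub_self, smul_zero, inner_zero_right, expI_zero, one_mul]
      rw [integral_profiles hb hd, mul_assoc w, ← Complex.ofReal_mul, ← abs_mul_abs_self, hD,
        one_mul, Complex.ofReal_one, mul_one]
    · intro μ _ hμ
      rw [integral_const_mul, integral_expI_mul_profiles_eq_zero hb hd, mul_zero]
      rw [norm_smul, Real.norm_of_nonneg (by linarith)]
      have := one_le_norm_natVec_sub hμ.symm
      nlinarith
  rw [Finset.sum_congr rfl hp, Finset.sum_const, Finset.card_product, card_box, nsmul_eq_mul]
  push_cast
  rw [show 2 * n * M = M * n + M * n by ring, pow_add]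
  ring

/-! ### The lower bound for the operator norm -/

lemma enorm_integral_mul_le {α : Type*} [MeasurableSpace α] {μ : Measure α} {f g : α → ℂ}
    (hf : AEStronglyMeasurable f μ) (hg : AEStronglyMeasurable g μ) {p : ℝ≥0∞} (hp : 1 ≤ p) :
    ‖∫ x, f x * g x ∂μ‖ₑ ≤ eLpNorm f p μ * eLpNorm g p.conjExponent μ := by
  have : p.HolderConjugate p.conjExponent := ENNReal.HolderConjugate.conjExponent hp
  calc ‖∫ x, f x * g x ∂μ‖ₑ ≤ ∫⁻ x, ‖f x * g x‖ₑ ∂μ := enorm_integral_le_lintegral_enorm _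
    _ = eLpNorm (f • g) 1 μ := by rw [eLpNorm_one_eq_lintegral_enorm]; rfl
    _ ≤ _ := eLpNorm_smul_le_mul_eLpNorm hg hf

lemma eLpNorm_schwartz_ne_top {n : ℕ} (f : 𝓢(Rn n, ℂ)) (p : ℝ≥0∞) :
    eLpNorm f p volume ≠ ∞ := (f.memLp p volume).eLpNorm_lt_top.ne

/-- A family of operators of order `m` acting on `2^M` frequencies is bounded only if its order
compensates for the number of frequencies. -/
theorem exists_rpow_mul_le {n : ℕ} (hn : 0 < n) {ρ : ℝ} (hρ0 : 0 ≤ ρ) (hρ : ρ < 1) (m : ℝ)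
    {p q r : ℝ≥0∞} (hr : 1 ≤ r) {θ : 𝓢(Rn n, ℂ)} (hθ : IsBump θ)
    (A : ℕ → (Fin n → ℕ) → ℝ) (hA : ∀ M κ, |A M κ| = 1)
    (hflat : ∀ M (y : Rn n), ‖∑ κ ∈ box n M, (A M κ : ℂ) * expI (inner ℝ y (natVec κ))‖ ≤
      √(2 ^ (M + 1)) ^ n)
    (c : ℕ → (Fin n → ℕ) × (Fin n → ℕ) → ℂ)
    (hc : ∀ i p, c i p = A (gridExp ρ (gap n * i)) p.1 * A (gridExp ρ (gap n * i)) p.2 *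
      A (gridExp ρ (gap n * i) + 1) (p.1 + p.2))
    (hbdd : IsBoundedFromTo (lacunarySymbol θ c ρ m) p q r) :
    ∃ K : ℝ, ∀ i : ℕ, (2 : ℝ) ^ (((gap n * i : ℕ) : ℝ) * m) *
      √(2 ^ gridExp ρ (gap n * i)) ^ n ≤ K := by
  obtain ⟨C, hC⟩ := hbdd
  obtain ⟨b, hb⟩ := exists_isProfile n
  obtain ⟨d, hd⟩ := exists_isTestProfile n
  set u : 𝓢(Rn n, ℂ) := 𝓕⁻ b with hu
  set v : 𝓢(Rn n, ℂ) := 𝓕⁻ d with hv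
  set κ₀ : ℝ := ‖(∫ ζ, b ζ) * ∫ ζ, b ζ‖ with hκ₀
  have hκ₀pos : 0 < κ₀ := norm_pos_iff.2 (mul_ne_zero hb.integral_ne_zero hb.integral_ne_zero)
  set U : ℝ≥0∞ := C * eLpNorm u p volume * eLpNorm u q volume * eLpNorm v r.conjExponent volume
    with hU
  have hUfin : U ≠ ∞ := by
    exact ENNReal.mul_ne_top (ENNReal.mul_ne_top (ENNReal.mul_ne_top ENNReal.coe_ne_top
      (eLpNorm_schwartz_ne_top u p)) (eLpNorm_schwartz_ne_top u q)) (eLpNorm_schwartz_ne_top v _)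
  -- The factor `4^n` collects the excess of the flatness bounds over `2^{3nM/2}`: `2^{n/2}` from
  -- each copy of `f` and `2^n` from the test function.
  refine ⟨U.toReal * 4 ^ n / κ₀, fun i => ?_⟩
  set J := gap n * i
  set M := gridExp ρ J
  set l := spacing ρ J
  have hl : 1 ≤ l := one_le_spacing hρ0 J
  set w : ℝ := (2 : ℝ) ^ ((J : ℝ) * m) with hw
  have hw0 : 0 ≤ w := by positivity
  obtain ⟨f, hf1, hf2⟩ := exists_modulated b (box n M) (A M) l
  set T : Rn n → ℂ := bilinearOp (lacunarySymbol θ c ρ m) f f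
  have hT : T = fun x => (w : ℂ) * ∑ p ∈ box n M ×ˢ box n M, (A (M + 1) (p.1 + p.2) : ℂ) *
      (expI (inner ℝ (l • x) (natVec (p.1 + p.2))) * (u x * u x)) :=
    funext fun x => bilinearOp_lacunarySymbol hn hθ hb A hA hρ0 hρ m i rfl rfl (A (M + 1))
      (hA (M + 1)) c (hc i) hf2 x
  set W : Rn n → ℂ := fun x => (∑ μ ∈ box n (M + 1), (A (M + 1) μ : ℂ) *
    expI (inner ℝ (-(l • x)) (natVec μ))) * v x with hW
  have hTc : Continuous T := by
    rw [hT]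
    have := u.continuous
    fun_prop
  have hWc : Continuous W := by
    have := v.continuous
    rw [hW]
    fun_prop
  have hpair : ‖∫ x, T x * W x‖ = w * 2 ^ (2 * n * M) * κ₀ := by
    rw [hT, integral_trig_mul_test hb hd (A (M + 1)) (hA (M + 1)) hl, norm_mul, norm_mul,
      Complex.norm_real, Real.norm_of_nonneg hw0, norm_pow, Complex.norm_ofNat]
  have hfle : ∀ p : ℝ≥0∞, eLpNorm f p volume ≤
      ENNReal.ofReal (√(2 ^ (M + 1)) ^ n) * eLpNorm u p volume := fun p => by
    refine eLpNorm_le_mul_eLpNorm_of_ae_le_mul (.of_forall fun x => ?_) p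
    rw [hf1, norm_mul]
    exact mul_le_mul_of_nonneg_right (hflat M _) (norm_nonneg _)
  have hWle : eLpNorm W r.conjExponent volume ≤
      ENNReal.ofReal (√(2 ^ (M + 1 + 1)) ^ n) * eLpNorm v r.conjExponent volume := by
    refine eLpNorm_le_mul_eLpNorm_of_ae_le_mul (.of_forall fun x => ?_) _
    rw [hW, norm_mul]
    exact mul_le_mul_of_nonneg_right (hflat (M + 1) _) (norm_nonneg _)
  have hmain : ENNReal.ofReal (w * 2 ^ (2 * n * M) * κ₀) ≤
      ENNReal.ofReal (√(2 ^ (M + 1)) ^ n * √(2 ^ (M + 1)) ^ n * √(2 ^ (M + 1 + 1)) ^ n) * U := by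
    rw [← hpair, ofReal_norm]
    refine (enorm_integral_mul_le hTc.aestronglyMeasurable hWc.aestronglyMeasurable hr).trans ?_
    calc _ ≤ (C * (ENNReal.ofReal (√(2 ^ (M + 1)) ^ n) * eLpNorm u p volume) *
          (ENNReal.ofReal (√(2 ^ (M + 1)) ^ n) * eLpNorm u q volume)) *
          (ENNReal.ofReal (√(2 ^ (M + 1 + 1)) ^ n) * eLpNorm v r.conjExponent volume) := by
          refine mul_le_mul' ((hC f f).trans ?_) hWle
          exact mul_le_mul' (mul_le_mul' le_rfl (hfle p)) (hfle q)
      _ = _ := by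
          rw [ENNReal.ofReal_mul (by positivity), ENNReal.ofReal_mul (by positivity), hU]
          ring
  set y : ℝ := √(2 ^ M) with hy
  have hy0 : 0 < y := Real.sqrt_pos.2 (by positivity)
  have hy2 : y ^ 2 = 2 ^ M := Real.sq_sqrt (by positivity)
  have hs1 : √(2 ^ (M + 1)) * √(2 ^ (M + 1)) = 2 * y ^ 2 := by
    rw [Real.mul_self_sqrt (by positivity), hy2, pow_succ]
    ring
  have hs2 : √(2 ^ (M + 1 + 1)) = 2 * y := by
    rw [Real.sqrt_eq_iff_mul_self_eq_of_pos (by positivity), pow_succ, pow_succ, ← hy2]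
    ring
  have hreal : w * 2 ^ (2 * n * M) * κ₀ ≤ (2 * y ^ 2) ^ n * (2 * y) ^ n * U.toReal := by
    rw [← mul_pow, hs1, hs2, ← ENNReal.ofReal_toReal hUfin,
      ← ENNReal.ofReal_mul (by positivity)] at hmain
    exact (ENNReal.ofReal_le_ofReal_iff (by positivity)).1 hmain
  rw [le_div_iff₀ hκ₀pos]
  have h1 : (2 : ℝ) ^ (2 * n * M) = (y ^ n) ^ 3 * y ^ n := by
    rw [mul_comm, pow_mul, ← hy2]
    ring
  have h2 : (2 * y ^ 2) ^ n * (2 * y) ^ n * U.toReal = (y ^ n) ^ 3 * (U.toReal * 4 ^ n) := by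
    rw [show (4 : ℝ) = 2 * 2 by norm_num]
    simp only [mul_pow]
    ring
  rw [h1, h2] at hreal
  refine le_of_mul_le_mul_left ?_ (show 0 < (y ^ n) ^ 3 by positivity)
  calc (y ^ n) ^ 3 * (w * y ^ n * κ₀) = w * ((y ^ n) ^ 3 * y ^ n) * κ₀ := by ring
    _ ≤ _ := hreal

/-- If the order exceeds the critical one, the lower bounds for the dyadic pieces are unbounded. -/
lemma critical_order_of_bounded {n : ℕ} {ρ m K : ℝ}
    (h : ∀ i : ℕ, (2 : ℝ) ^ (((gap n * i : ℕ) : ℝ) * m) *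
      √(2 ^ gridExp ρ (gap n * i)) ^ n ≤ K) : m ≤ -(1 - ρ) * n / 2 := by
  by_contra! hm
  -- The bounded quantity is comparable to `2^{Jα}`, which is unbounded along `J = gap n * i` if `α
  -- > 0`.
  set α : ℝ := m + (1 - ρ) * n / 2 with hα
  have hα0 : 0 < α := by rw [hα]; linarith
  have hbound : ∀ i : ℕ, ((2 : ℝ) ^ α) ^ i ≤ 2 ^ n * max K 0 := fun i => by
    set J := gap n * i with hJ
    have h1 : (2 : ℝ) ^ ((J : ℝ) * (1 - ρ) / 2) ≤ 2 * √(2 ^ gridExp ρ J) := by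
      have h2 := le_two_pow_gridExp ρ J
      have h3 : ((2 : ℝ) ^ ((J : ℝ) * (1 - ρ) / 2)) ^ 2 = (2 : ℝ) ^ ((J : ℝ) * (1 - ρ)) := by
        rw [← Real.rpow_natCast, ← Real.rpow_mul (by norm_num)]
        congr 1
        push_cast
        ring
      refine (pow_le_pow_iff_left₀ (by positivity) (by positivity) two_ne_zero).1 ?_
      rw [h3, mul_pow, Real.sq_sqrt (by positivity)]
      have : (0 : ℝ) < 2 ^ gridExp ρ J := by positivity
      linarith
    have h4 : (2 : ℝ) ^ ((J : ℝ) * α) ≤ 2 ^ n * max K 0 := by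
      have h5 : (2 : ℝ) ^ ((J : ℝ) * α) =
          (2 : ℝ) ^ ((J : ℝ) * m) * ((2 : ℝ) ^ ((J : ℝ) * (1 - ρ) / 2)) ^ n := by
        rw [← Real.rpow_natCast, ← Real.rpow_mul (by norm_num), ← Real.rpow_add (by norm_num), hα]
        congr 1
        ring
      rw [h5]
      calc _ ≤ (2 : ℝ) ^ ((J : ℝ) * m) * (2 * √(2 ^ gridExp ρ J)) ^ n := by gcongr
        _ = 2 ^ n * ((2 : ℝ) ^ ((J : ℝ) * m) * √(2 ^ gridExp ρ J) ^ n) := by ring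
        _ ≤ 2 ^ n * max K 0 := by
          gcongr
          exact (h i).trans (le_max_left _ _)
    refine le_trans ?_ h4
    rw [← Real.rpow_natCast, ← Real.rpow_mul (by norm_num)]
    refine Real.rpow_le_rpow_of_exponent_le (by norm_num) ?_
    rw [mul_comm]
    gcongr
    exact_mod_cast Nat.le_mul_of_pos_left i (show 0 < gap n by unfold gap; omega)
  obtain ⟨i, hi⟩ := pow_unbounded_of_one_lt (2 ^ n * max K 0)
    (Real.one_lt_rpow (by norm_num : (1 : ℝ) < 2) hα0)
  exact absurd (hbound i) (not_le.2 hi)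

end BilinearPDO

end

theorem proposition7p1 (n : ℕ) (hn : 0 < n)
    (φ : SchwartzMap (BilinearPDO.Rn n) ℂ) (hφ : BilinearPDO.IsLPGenerator φ)
    (Φ : SchwartzMap (WithLp 2 (BilinearPDO.Rn n × BilinearPDO.Rn n)) ℂ)
    (hΦ : BilinearPDO.IsLPGenerator Φ)
    (ρ : ℝ) (hρ0 : 0 ≤ ρ) (hρ1 : ρ < 1) (m : ℝ)
    (s : Fin 3 → ℝ) (hs : ∀ i, 0 ≤ s i)
    (p q r : ENNReal) (hr1 : 1 ≤ r) (hr2 : r ≤ 2) (hp : 2 ≤ p) (hq : 2 ≤ q)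
    (hpqr : 1 / p + 1 / q = 1 / r)
    (hbdd : ∀ σ ∈ BilinearPDO.symbolClass φ Φ m ρ s, BilinearPDO.IsBoundedFromTo σ p q r) :
    m ≤ -(1 - ρ) * (n : ℝ) / 2 := by
  by_contra! hm
  have hn' : (0 : ℝ) < n := by exact_mod_cast hn
  have hneg : -(1 - ρ) * (n : ℝ) / 2 < 0 := by nlinarith
  -- `m' < m` leaves room for the interpolation loss, `m' < 0` makes the symbol bounded, and `m'`
  -- still exceeds the critical order.
  obtain ⟨m', hm1, hm2⟩ := exists_between (lt_min hm hneg)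
  obtain ⟨θ, hθ⟩ := BilinearPDO.exists_isBump n
  choose A hA hflat using BilinearPDO.exists_flat_trigPoly n
  let M : ℕ → ℕ := fun i => BilinearPDO.gridExp ρ (BilinearPDO.gap n * i)
  let c : ℕ → (Fin n → ℕ) × (Fin n → ℕ) → ℂ := fun i p =>
    A (M i) p.1 * A (M i) p.2 * A (M i + 1) (p.1 + p.2)
  have hc : ∀ i p, ‖c i p‖ ≤ 1 := fun i p => by
    simp only [c, norm_mul, Complex.norm_real, Real.norm_eq_abs, hA, mul_one, le_refl]
  have hmem := BilinearPDO.lacunarySymbol_mem_symbolClass hn φ hφ hθ hΦ hc hρ0 hρ1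
    (lt_of_lt_of_le hm2 (min_le_left _ _)) (lt_of_lt_of_le hm2 (min_le_right _ _)).le s
  obtain ⟨K, hK⟩ := BilinearPDO.exists_rpow_mul_le hn hρ0 hρ1 m' hr1 hθ A hA hflat c
    (fun _ _ => rfl) (hbdd _ hmem)
  exact absurd (BilinearPDO.critical_order_of_bounded hK) (not_le.2 hm1)
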